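/- Let $N\ge 1$, $\alpha\in(0,2)$ and $H=(H_1,\dots,H_N)\in(0,1)^N$. Write $\widehat g(\xi)=(2\pi)^{-1/2}\int_{\mathbb R}e^{-is\xi}g(s)\,ds$. Let $\psi$ be a Lemarié–Meyer mother wavelet: a real-valued Schwartz function on $\mathbb R$ with $\operatorname{supp}\widehat\psi\subseteq\{\xi:\ 2\pi/3\le|\xi|\le 8\pi/3\}$ such that the functions $\psi_{j,k}(x)=2^{j/2}\psi(2^jx-k)$, $(j,k)\in\mathbb Z^2$, form an orthonormal basis of $L^2(\mathbb R)$. For $v\in(0,1)$, $x,y,\xi\in\mathbb R$ and $(j,k)\in\mathbb Z^2$ put $$f_v(x,\xi)=\frac{e^{ix\xi}-1}{|\xi|^{v+1/\alpha}}\ (\xi\ne0),\quad f_v(x,0)=0,\qquad \psi^v(y)=\int_{\mathbb R}e^{iy\eta}\frac{\widehat\psi(\eta)}{|\eta|^{v+1/\alpha}}\,d\eta,$$ $$\widehat\psi_{\alpha,j,k}=2^{-j(1/\alpha-1/2)}\,\widehat{\psi_{j,k}},\qquad w^v_{\alpha,j,k}(x)=2^{j(1/\alpha-1/2)}\int_{\mathbb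 R}f_v(x,\xi)\,\widehat{\psi_{j,k}}(\xi)\,d\xi,$$ and for $J,K\in\mathbb Z^N$ and $\lambda\in\mathbb R^N$ put $\widehat\Psi_{\alpha,J,K}(\lambda)=\prod_{l=1}^N\widehat\psi_{\alpha,j_l,k_l}(\lambda_l)$. Let $\widetilde M_\alpha$ be a complex-valued rotationally invariant $\alpha$-stable random measure on $\mathbb R^N$ with Lebesgue control measure: for Borel sets $A$ of finite Lebesgue measure $|A|$, $\widetilde M_\alpha(A)$ is a complex random variable with $\mathbb E\exp\big(i\,\mathrm{Re}(\bar z\,\widetilde M_\alpha(A))\big)=\exp(-c|z|^\alpha|A|)$ for all $z\in\mathbb C$ (where $c>0$ is a fixed normalizing constant), its values on finitely many disjoint sets are independent, and for every sequence of disjoint Borel sets whose union has finite measure it is almost surely $\sigma$-additive along that sequence. For $f\in L^\alpha(\mathbb R^N)$, $\int f\,d\widetilde M_\alpha$ denotes the limit in probability of the integrals $\sum_i z_i\widetilde M_\alpha(A_i)$ of simple functions $\sum_i z_i\mathbf 1_{A_i}$ (with $A_i$ disjoint and of finite measure) that converge to $f$ in $L^\alpha(\mathbb R^N)$. Let $$Z^H(t)=\mathrm{Re}\int_{\mathbb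 R^N}\prod_{l=1}^N f_{H_l}(t_l,\lambda_l)\,\widetilde M_\alpha(d\lambda),\qquad \epsilon_{J,K}=\int_{\mathbb R^N}\overline{\widehat\Psi_{\alpha,J,K}(\lambda)}\,\widetilde M_\alpha(d\lambda).$$ Let $(\mathcal D_n)_{n\in\mathbb N}$ be finite subsets of $\mathbb Z^N\times\mathbb Z^N$ with $\mathcal D_n\subset\mathcal D_{n+1}$ for all $n$ and $\bigcup_n\mathcal D_n=\mathbb Z^N\times\mathbb Z^N$, and let $$U_n(t)=\mathrm{Re}\sum_{(J,K)\in\mathcal D_n}2^{-\langle J,H\rangle}\,\epsilon_{J,K}\prod_{l=1}^N\big\{\psi^{H_l}(2^{j_l}t_l-k_l)-\psi^{H_l}(-k_l)\big\}.$$ Then the stochastic integrals defining $\epsilon_{J,K}$ and $Z^H(t)$ exist (in particular their integrands belong to $L^\alpha(\mathbb R^N)$), and for every $t\in\mathbb R^N$: 1. the wavelet expansion of the kernel converges in $L^\alpha(\mathbb R^N)$: $$\sum_{(J,K)\in\mathcal D_n}\Big\{\prod_{l=1}^N w^{H_l}_{\alpha,j_l,k_l}(t_l)\Big\}\overline{\widehat\Psi_{\alpha,J,K}}\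 \longrightarrow\ \prod_{l=1}^N f_{H_l}(t_l,\cdot)\quad\text{as }n\to\infty,$$ that is, $\int_{\mathbb R^N}|\text{difference}|^\alpha\,d\lambda\to0$; 2. $U_n(t)$ converges in probability to $Z^H(t)$ as $n\to\infty$. -/

import Mathlib

open MeasureTheory ProbabilityTheory Filter Topology
open scoped ENNReal SchwartzMap ComplexConjugate

namespace HFSS

noncomputable section

/-! ### Fourier transform and Lemarié–Meyer wavelets on the line -/

/-- The unitary Fourier transform `ĝ(ξ) = (2π)^{-1/2} ∫ e^{-isξ} g(s) ds`. -/
def fourierHat (g : ℝ → ℂ) (ξ : ℝ) : ℂ :=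
  (((2 * Real.pi) ^ (-(1 / 2 : ℝ)) : ℝ) : ℂ) *
    ∫ s : ℝ, Complex.exp (-(Complex.I * (s : ℂ) * (ξ : ℂ))) * g s

/-- `ψ_{j,k}(x) = 2^{j/2} ψ(2^j x - k)`, regarded as a complex-valued function. -/
def psiJK (ψ : ℝ → ℝ) (j k : ℤ) (x : ℝ) : ℂ :=
  (((2 : ℝ) ^ ((j : ℝ) / 2) * ψ ((2 : ℝ) ^ j * x - (k : ℝ)) : ℝ) : ℂ)

/-- A Lemarié–Meyer mother wavelet: a real-valued Schwartz function whose Fourier transform is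
supported in the ring `2π/3 ≤ |ξ| ≤ 8π/3`, and whose dyadic dilations and integer translations
`ψ_{j,k}` form an orthonormal basis of `L²(ℝ)`. -/
structure IsLemarieMeyer (ψ : 𝓢(ℝ, ℝ)) : Prop where
  support_hat : tsupport (fourierHat fun x => (ψ x : ℂ)) ⊆
    {ξ : ℝ | 2 * Real.pi / 3 ≤ |ξ| ∧ |ξ| ≤ 8 * Real.pi / 3}
  orthonormal_basis : ∃ b : HilbertBasis (ℤ × ℤ) ℂ (Lp ℂ 2 (volume : Measure ℝ)),
    ∀ j k : ℤ, (b (j, k) : ℝ → ℂ) =ᵐ[volume] psiJK ψ j k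

/-- `ψ̂_{α,j,k} = 2^{-j(1/α - 1/2)} ψ̂_{j,k}`, where `ψ̂_{j,k}` is the Fourier transform of
`ψ_{j,k}`. -/
def psiHat (α : ℝ) (ψ : ℝ → ℝ) (j k : ℤ) (ξ : ℝ) : ℂ :=
  (((2 : ℝ) ^ (-((j : ℝ) * (1 / α - 1 / 2))) : ℝ) : ℂ) * fourierHat (psiJK ψ j k) ξ

/-- `f_v(x, ξ) = (e^{ixξ} - 1) / |ξ|^{v + 1/α}`; its value at `ξ = 0` is `0`. -/
def fKer (α v x ξ : ℝ) : ℂ :=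
  (Complex.exp (Complex.I * (x : ℂ) * (ξ : ℂ)) - 1) / ((|ξ| ^ (v + 1 / α) : ℝ) : ℂ)

/-- `w^v_{α,j,k}(x) = 2^{j(1/α - 1/2)} ∫ f_v(x, ξ) ψ̂_{j,k}(ξ) dξ`. -/
def wCoeff (α : ℝ) (ψ : ℝ → ℝ) (v : ℝ) (j k : ℤ) (x : ℝ) : ℂ :=
  (((2 : ℝ) ^ ((j : ℝ) * (1 / α - 1 / 2)) : ℝ) : ℂ) *
    ∫ ξ : ℝ, fKer α v x ξ * fourierHat (psiJK ψ j k) ξ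

/-- `ψ^v(y) = ∫ e^{iyη} ψ̂(η) / |η|^{v + 1/α} dη`. -/
def psiFrac (α : ℝ) (ψ : ℝ → ℝ) (v y : ℝ) : ℂ :=
  ∫ η : ℝ, Complex.exp (Complex.I * (y : ℂ) * (η : ℂ)) *
    (fourierHat (fun x => (ψ x : ℂ)) η / ((|η| ^ (v + 1 / α) : ℝ) : ℂ))

/-! ### Tensor products on `ℝ^N` -/

/-- `Ψ̂_{α,J,K}(λ) = ∏_l ψ̂_{α,j_l,k_l}(λ_l)`. -/
def bigPsiHat {N : ℕ} (α : ℝ) (ψ : ℝ → ℝ) (J K : Fin N → ℤ) (x : Fin N → ℝ) : ℂ :=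
  ∏ l, psiHat α ψ (J l) (K l) (x l)

/-- The harmonizable kernel `λ ↦ ∏_l (e^{i t_l λ_l} - 1) / |λ_l|^{H_l + 1/α}`. -/
def kernel {N : ℕ} (α : ℝ) (H t : Fin N → ℝ) (x : Fin N → ℝ) : ℂ :=
  ∏ l, fKer α (H l) (t l) (x l)

/-! ### Rotationally invariant stable random measures and their integrals -/

/-- `M` is a complex-valued rotationally invariant `α`-stable random measure on `ℝ^N` with Lebesgue
control measure: for each Borel set `A` of finite Lebesgue measure, `M A` is a complex random
variable with `E exp(i Re(conj z · M A)) = exp(-c |z|^α |A|)`; the values on disjoint sets are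
independent, and `M` is almost surely `σ`-additive along each sequence of disjoint sets. The
constant `c > 0` only fixes the normalization of the scale parameter. The values of `M` on sets
that are not Borel or have infinite measure are irrelevant. -/
structure IsStableRandomMeasure {N : ℕ} {Ω : Type*} [MeasurableSpace Ω] (α c : ℝ)
    (M : Set (Fin N → ℝ) → Ω → ℂ) (P : Measure Ω) : Prop where
  measurable : ∀ A, MeasurableSet A → volume A < ∞ → Measurable (M A)
  charFun_eq : ∀ A, MeasurableSet A → volume A < ∞ → ∀ z : ℂ,
    charFun (P.map (M A)) z = ((Real.exp (-(c * ‖z‖ ^ α * (volume A).toReal)) : ℝ) : ℂ)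
  independent : ∀ (n : ℕ) (A : Fin n → Set (Fin N → ℝ)), (∀ i, MeasurableSet (A i)) →
    (∀ i, volume (A i) < ∞) → Pairwise (fun i j => Disjoint (A i) (A j)) →
    iIndepFun (fun i => M (A i)) P
  sigma_additive : ∀ A : ℕ → Set (Fin N → ℝ), (∀ i, MeasurableSet (A i)) →
    volume (⋃ i, A i) < ∞ → Pairwise (fun i j => Disjoint (A i) (A j)) →
    ∀ᵐ ω ∂P, Tendsto (fun n => ∑ i ∈ Finset.range n, M (A i) ω) atTop (𝓝 (M (⋃ i, A i) ω))

/-- The integral `∑_z z · M(s = z)` of a simple function `s` with respect to `M`. -/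
def simpleIntegral {N : ℕ} {Ω : Type*} (M : Set (Fin N → ℝ) → Ω → ℂ)
    (s : SimpleFunc (Fin N → ℝ) ℂ) (ω : Ω) : ℂ :=
  ∑ z ∈ s.range, z * M (s ⁻¹' {z}) ω

/-- The random variable `X` is the stochastic integral of `f ∈ L^α(ℝ^N)` with respect to `M`:
it is the limit in probability of the integrals of simple functions, vanishing off a set of
finite measure, that converge to `f` in `L^α(ℝ^N)`. -/
def IsStableIntegral {N : ℕ} {Ω : Type*} [MeasurableSpace Ω] (α : ℝ)
    (M : Set (Fin N → ℝ) → Ω → ℂ) (P : Measure Ω) (f : (Fin N → ℝ) → ℂ) (X : Ω → ℂ) : Prop :=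
  MemLp f (ENNReal.ofReal α) volume ∧ Measurable X ∧
    ∃ s : ℕ → SimpleFunc (Fin N → ℝ) ℂ, (∀ n, (s n).FinMeasSupp volume) ∧
      Tendsto (fun n => eLpNorm (fun x => s n x - f x) (ENNReal.ofReal α) volume) atTop (𝓝 0) ∧
      TendstoInMeasure P (fun n => simpleIntegral M (s n)) atTop X

open Classical in
/-- The stochastic integral `∫ f dM` (a version of it; `0` if `f` has no integral). -/
def stableIntegral {N : ℕ} {Ω : Type*} [MeasurableSpace Ω] (α : ℝ)
    (M : Set (Fin N → ℝ) → Ω → ℂ) (P : Measure Ω) (f : (Fin N → ℝ) → ℂ) : Ω → ℂ :=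
  if h : ∃ X, IsStableIntegral α M P f X then h.choose else 0

/-! ### The harmonizable fractional stable sheet and its wavelet series -/

/-- `Z^H(t) = Re ∫ ∏_l (e^{i t_l λ_l} - 1) / |λ_l|^{H_l + 1/α} M(dλ)`. -/
def sheet {N : ℕ} {Ω : Type*} [MeasurableSpace Ω] (α : ℝ)
    (M : Set (Fin N → ℝ) → Ω → ℂ) (P : Measure Ω) (H t : Fin N → ℝ) (ω : Ω) : ℝ :=
  (stableIntegral α M P (kernel α H t) ω).re

/-- `ε_{J,K} = ∫ conj(Ψ̂_{α,J,K}) dM`. -/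
def epsJK {N : ℕ} {Ω : Type*} [MeasurableSpace Ω] (α : ℝ) (ψ : ℝ → ℝ)
    (M : Set (Fin N → ℝ) → Ω → ℂ) (P : Measure Ω) (J K : Fin N → ℤ) : Ω → ℂ :=
  stableIntegral α M P (fun x => conj (bigPsiHat α ψ J K x))

/-- The partial sum over `D` of the random wavelet series,
`Re ∑_{(J,K) ∈ D} 2^{-⟨J,H⟩} ε_{J,K} ∏_l (ψ^{H_l}(2^{j_l} t_l - k_l) - ψ^{H_l}(-k_l))`. -/
def partialSum {N : ℕ} {Ω : Type*} [MeasurableSpace Ω] (α : ℝ) (ψ : ℝ → ℝ)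
    (M : Set (Fin N → ℝ) → Ω → ℂ) (P : Measure Ω) (H : Fin N → ℝ)
    (D : Finset ((Fin N → ℤ) × (Fin N → ℤ))) (t : Fin N → ℝ) (ω : Ω) : ℝ :=
  (∑ p ∈ D, (((2 : ℝ) ^ (-(∑ l, (p.1 l : ℝ) * H l)) : ℝ) : ℂ) * epsJK α ψ M P p.1 p.2 ω *
    ∏ l, (psiFrac α ψ (H l) ((2 : ℝ) ^ (p.1 l) * t l - (p.2 l : ℝ)) -
      psiFrac α ψ (H l) (-(p.2 l : ℝ)))).re

end

end HFSS

/-!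
Since `ψ` is real, the conjugates of the `ψ̂_{j,k}` also form an orthonormal basis of `L²(ℝ)`.
A `ψ̂_{j,k}` that does not vanish at `ξ ≠ 0` is supported in `|ξ| / 4 ≤ |η| ≤ 4|ξ|`, so near `ξ` the
expansion does not see the singularity of `f_v(x, ·)` at `0`: cutting it off to compact annuli
shows that `∑ w^v_{α,j,k}(x) conj ψ̂_{α,j,k}(ξ) = f_v(x, ξ)` for almost every `ξ` at which the sum
converges absolutely.

Only the scales with `2^j ≈ |ξ|` contribute at `ξ`, and a change of variables gives
`w^v_{α,j,k}(x) = 2^{-jv} (ψ^v(2^j x - k) - ψ^v(-k))`. The quadratic decay of `ψ^v` and of its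
derivative then bounds the sum of the absolute values by a multiple of
`|ξ|^{-(v + 1/α)} min(1, |ξ|)`, which belongs to `L^α(ℝ)` because `0 < v < 1`. Products of these
bounds dominate all partial sums on `ℝ^N`, so the kernel expansion converges unconditionally
in `L^α`.

The stable characteristic function gives `P(|∫ f dM| > r) ≤ C r^{-α} ∫ |f|^α`, so stochastic
integration carries convergence in `L^α` to convergence in probability.
-/

namespace HFSS

noncomputable section

section StableMeasure

lemma simpleIntegral_zero {N : ℕ} {Ω : Type*} (M : Set (Fin N → ℝ) → Ω → ℂ) :
    simpleIntegral M 0 = 0 := by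
  funext ω
  refine Finset.sum_eq_zero fun z hz => ?_
  obtain ⟨x, rfl⟩ := SimpleFunc.mem_range.1 hz
  simp

lemma simpleIntegral_eq_sum_ne_zero {N : ℕ} {Ω : Type*} (M : Set (Fin N → ℝ) → Ω → ℂ)
    (s : SimpleFunc (Fin N → ℝ) ℂ) (ω : Ω) :
    simpleIntegral M s ω = ∑ z ∈ s.range with z ≠ 0, z * M (s ⁻¹' {z}) ω := by
  rw [simpleIntegral, Finset.sum_filter_of_ne]
  exact fun z _ hz => left_ne_zero_of_mul hz

variable {N : ℕ} {Ω : Type*} [MeasurableSpace Ω] {P : Measure Ω} {α c : ℝ}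
  {M : Set (Fin N → ℝ) → Ω → ℂ}

lemma IsStableRandomMeasure.ae_empty (hM : IsStableRandomMeasure α c M P) :
    ∀ᵐ ω ∂P, M ∅ ω = 0 := by
  have h := hM.sigma_additive (fun _ => ∅) (by simp) (by simp) (by intro i j _; simp)
  filter_upwards [h] with ω hω
  have hdiff := (hω.comp (tendsto_add_atTop_nat 1)).sub hω
  simpa [Function.comp_def, add_mul, tendsto_const_nhds_iff] using hdiff

lemma IsStableRandomMeasure.ae_union (hM : IsStableRandomMeasure α c M P)
    {A B : Set (Fin N → ℝ)} (hA : MeasurableSet A) (hB : MeasurableSet B)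
    (hA' : volume A < ∞) (hB' : volume B < ∞) (hAB : Disjoint A B) :
    ∀ᵐ ω ∂P, M (A ∪ B) ω = M A ω + M B ω := by
  let S : ℕ → Set (Fin N → ℝ)
    | 0 => A
    | 1 => B
    | _ + 2 => ∅
  have hU : ⋃ i, S i = A ∪ B := by
    rw [← Set.union_iUnion_nat_succ, ← Set.union_iUnion_nat_succ]
    simp [S]
  have h := hM.sigma_additive S (fun | 0 => hA | 1 => hB | _ + 2 => MeasurableSet.empty)
    (by simpa [hU] using measure_union_lt_top hA' hB')
    (fun
      | 0, 0, h | 1, 1, h => absurd rfl h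
      | 0, 1, _ => hAB
      | 1, 0, _ => hAB.symm
      | _ + 2, _, _ => Set.empty_disjoint _
      | 0, _ + 2, _ | 1, _ + 2, _ => Set.disjoint_empty _)
  filter_upwards [h, hM.ae_empty] with ω hω h0
  rw [hU, ← tendsto_add_atTop_iff_nat 2] at hω
  refine tendsto_nhds_unique hω (tendsto_const_nhds.congr fun n => ?_)
  simp [Finset.sum_range_succ', S, h0, add_comm]

lemma IsStableRandomMeasure.ae_biUnion (hM : IsStableRandomMeasure α c M P) {ι : Type*}
    (s : Finset ι) {A : ι → Set (Fin N → ℝ)} (hA : ∀ i ∈ s, MeasurableSet (A i))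
    (hA' : ∀ i ∈ s, volume (A i) < ∞) (hd : (s : Set ι).PairwiseDisjoint A) :
    ∀ᵐ ω ∂P, M (⋃ i ∈ s, A i) ω = ∑ i ∈ s, M (A i) ω := by
  classical
  induction s using Finset.induction_on with
  | empty => simpa using hM.ae_empty
  | insert a s ha ih =>
    simp only [Finset.forall_mem_insert] at hA hA'
    have hrest := ih hA.2 hA'.2 (hd.subset (by simp))
    have hunion := hM.ae_union hA.1 (s.measurableSet_biUnion hA.2) hA'.1
      (measure_biUnion_lt_top s.finite_toSet hA'.2)
      (Set.disjoint_iUnion₂_right.2 fun i hi =>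
        hd (by simp) (by simp [hi]) (ne_of_mem_of_not_mem hi ha).symm)
    filter_upwards [hrest, hunion] with ω hrest hunion
    rw [Finset.set_biUnion_insert, hunion, hrest, Finset.sum_insert ha]

lemma IsStableRandomMeasure.nonneg [IsProbabilityMeasure P]
    (hM : IsStableRandomMeasure α c M P) : 0 ≤ c := by
  have hfin : volume (Set.Icc (0 : Fin N → ℝ) 1) < ∞ := isCompact_Icc.measure_lt_top
  have : IsProbabilityMeasure (P.map (M (Set.Icc 0 1))) :=
    Measure.isProbabilityMeasure_map (hM.measurable _ measurableSet_Icc hfin).aemeasurable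
  have hle := norm_charFun_le_one (μ := P.map (M (Set.Icc 0 1))) (t := 1)
  rw [hM.charFun_eq _ measurableSet_Icc hfin, Complex.norm_real,
    Real.norm_of_nonneg (Real.exp_nonneg _)] at hle
  simpa [Real.volume_Icc_pi] using hle

lemma IsStableRandomMeasure.iIndepFun (hM : IsStableRandomMeasure α c M P) {ι : Type*}
    [Finite ι] {A : ι → Set (Fin N → ℝ)} (hA : ∀ i, MeasurableSet (A i))
    (hA' : ∀ i, volume (A i) < ∞) (hd : Pairwise (Function.onFun Disjoint A)) :
    iIndepFun (fun i => M (A i)) P := by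
  obtain ⟨n, ⟨e⟩⟩ := Finite.exists_equiv_fin ι
  have h := hM.independent n (A ∘ e.symm) (fun _ => hA _) (fun _ => hA' _)
    fun i j hij => hd (e.symm.injective.ne hij)
  simpa using h.precomp e.injective

lemma simpleIntegral_map (hM : IsStableRandomMeasure α c M P) {β : Type*}
    (r : SimpleFunc (Fin N → ℝ) β) (g : β → ℂ)
    (hr : ∀ y, g y ≠ 0 → volume (r ⁻¹' {y}) < ∞) :
    ∀ᵐ ω ∂P, simpleIntegral M (r.map g) ω = ∑ y ∈ r.range, g y * M (r ⁻¹' {y}) ω := by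
  classical
  have hfiber : ∀ z ∈ (r.map g).range, ∀ᵐ ω ∂P,
      z * M ((r.map g) ⁻¹' {z}) ω = ∑ y ∈ r.range with g y = z, g y * M (r ⁻¹' {y}) ω := by
    intro z _
    obtain rfl | hz := eq_or_ne z 0
    · refine Eventually.of_forall fun ω => ?_
      rw [zero_mul, Finset.sum_eq_zero]
      intro y hy
      rw [(Finset.mem_filter.1 hy).2, zero_mul]
    · have h := hM.ae_biUnion (r.range.filter fun y => g y = z) (A := fun y => r ⁻¹' {y})
        (fun y _ => r.measurableSet_fiber y)
        (fun y hy => hr y (by rwa [(Finset.mem_filter.1 hy).2]))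
        (fun i _ j _ hij => Disjoint.preimage _ (by simpa using hij))
      filter_upwards [h] with ω hω
      have hset : (r.map g) ⁻¹' {z} = ⋃ y ∈ r.range.filter (fun y => g y = z), r ⁻¹' {y} := by
        ext x
        simp
      rw [hset, hω, Finset.mul_sum]
      refine Finset.sum_congr rfl fun y hy => ?_
      rw [(Finset.mem_filter.1 hy).2]
  filter_upwards [(Finset.eventually_all (r.map g).range).2 hfiber] with ω hω
  rw [simpleIntegral, Finset.sum_congr rfl hω]
  refine Finset.sum_fiberwise_of_maps_to (fun y hy => ?_) _
  rw [SimpleFunc.range_map]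
  exact Finset.mem_image_of_mem g hy

lemma finMeasSupp_smul_add_smul {E : Type*} [MeasurableSpace E] {μ : Measure E}
    {s t : SimpleFunc E ℂ} (hs : s.FinMeasSupp μ) (ht : t.FinMeasSupp μ) (a b : ℂ) :
    (a • s + b • t).FinMeasSupp μ :=
  (hs.map (smul_zero a)).add (ht.map (smul_zero b))

lemma simpleIntegral_smul_add_smul (hM : IsStableRandomMeasure α c M P)
    {s t : SimpleFunc (Fin N → ℝ) ℂ} (hs : s.FinMeasSupp volume) (ht : t.FinMeasSupp volume)
    (a b : ℂ) :
    simpleIntegral M (a • s + b • t) =ᵐ[P] a • simpleIntegral M s + b • simpleIntegral M t := by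
  have hfin : ∀ g : ℂ × ℂ → ℂ, g 0 = 0 → ∀ p, g p ≠ 0 → volume ((s.pair t) ⁻¹' {p}) < ∞ :=
    fun g hg p hp => (hs.pair ht).meas_preimage_singleton_ne_zero (by rintro rfl; exact hp hg)
  have hsum := simpleIntegral_map hM (s.pair t) (fun p => a * p.1 + b * p.2) (hfin _ (by simp))
  have hfst := simpleIntegral_map hM (s.pair t) Prod.fst (hfin _ rfl)
  have hsnd := simpleIntegral_map hM (s.pair t) Prod.snd (hfin _ rfl)
  rw [SimpleFunc.map_fst_pair] at hfst
  rw [SimpleFunc.map_snd_pair] at hsnd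
  rw [show (s.pair t).map (fun p => a * p.1 + b * p.2) = a • s + b • t by ext; simp] at hsum
  filter_upwards [hsum, hfst, hsnd] with ω hsum hfst hsnd
  simp only [Pi.add_apply, Pi.smul_apply, smul_eq_mul, hsum, hfst, hsnd, Finset.mul_sum,
    ← Finset.sum_add_distrib]
  exact Finset.sum_congr rfl fun y _ => by ring

lemma finMeasSupp_sub {E : Type*} [MeasurableSpace E] {μ : Measure E} {s t : SimpleFunc E ℂ}
    (hs : s.FinMeasSupp μ) (ht : t.FinMeasSupp μ) : (s - t).FinMeasSupp μ :=
  hs.map₂ ht (op := fun x y => x - y) (sub_zero 0)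

lemma simpleIntegral_sub (hM : IsStableRandomMeasure α c M P)
    {s t : SimpleFunc (Fin N → ℝ) ℂ} (hs : s.FinMeasSupp volume) (ht : t.FinMeasSupp volume) :
    simpleIntegral M (s - t) =ᵐ[P] simpleIntegral M s - simpleIntegral M t := by
  simpa [show s + -t = s - t by ext; simp [sub_eq_add_neg], sub_eq_add_neg (simpleIntegral M s)]
    using simpleIntegral_smul_add_smul hM hs ht 1 (-1)

lemma measurable_simpleIntegral (hM : IsStableRandomMeasure α c M P)
    {s : SimpleFunc (Fin N → ℝ) ℂ} (hs : s.FinMeasSupp volume) :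
    Measurable (simpleIntegral M s) := by
  refine Finset.measurable_fun_sum _ fun z _ => ?_
  obtain rfl | hz := eq_or_ne z 0
  · simp
  · exact (hM.measurable _ (s.measurableSet_fiber z)
      (hs.meas_preimage_singleton_ne_zero hz)).const_mul z

lemma lintegral_enorm_rpow_simpleFunc {E : Type*} [MeasurableSpace E] {μ : Measure E}
    (hα : 0 < α) (s : SimpleFunc E ℂ) :
    ∫⁻ x, ‖s x‖ₑ ^ α ∂μ = ∑ z ∈ s.range with z ≠ 0, ‖z‖ₑ ^ α * μ (s ⁻¹' {z}) := by
  have hmap : ∫⁻ x, ‖s x‖ₑ ^ α ∂μ = ∫⁻ x, (s.map fun z => ‖z‖ₑ ^ α) x ∂μ := rfl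
  rw [hmap, SimpleFunc.lintegral_eq_lintegral, SimpleFunc.map_lintegral, Finset.sum_filter_of_ne]
  rintro z _ hz rfl
  simp [hα] at hz

lemma charFun_map_const_mul {X : Ω → ℂ} (hX : Measurable X) (z w : ℂ) :
    charFun (P.map fun ω => z * X ω) w = charFun (P.map X) (conj z * w) := by
  simp only [charFun_apply]
  rw [integral_map (by fun_prop) (by fun_prop), integral_map (by fun_prop) (by fun_prop)]
  simp only [Complex.inner, map_mul, mul_assoc]
  simp only [mul_comm, mul_left_comm]

lemma IsStableRandomMeasure.charFun_const_mul (hM : IsStableRandomMeasure α c M P)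
    {A : Set (Fin N → ℝ)} (hA : MeasurableSet A) (hA' : volume A < ∞) (z w : ℂ) :
    charFun (P.map fun ω => z * M A ω) w =
      ((Real.exp (-(c * ‖w‖ ^ α * (‖z‖ₑ ^ α * volume A).toReal)) : ℝ) : ℂ) := by
  rw [charFun_map_const_mul (hM.measurable A hA hA'), hM.charFun_eq A hA hA', norm_mul,
    Complex.norm_conj, Real.mul_rpow (norm_nonneg _) (norm_nonneg _), ENNReal.toReal_mul,
    ← ENNReal.toReal_rpow, toReal_enorm]
  congr 3
  ring

lemma charFun_simpleIntegral (hM : IsStableRandomMeasure α c M P) (hα : 0 < α)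
    {s : SimpleFunc (Fin N → ℝ) ℂ} (hs : s.FinMeasSupp volume) (w : ℂ) :
    charFun (P.map (simpleIntegral M s)) w =
      ((Real.exp (-(c * ‖w‖ ^ α * (∫⁻ x, ‖s x‖ₑ ^ α).toReal)) : ℝ) : ℂ) := by
  classical
  set R : Finset ℂ := s.range.filter (· ≠ 0) with hR
  have hfin : ∀ z ∈ R, volume (s ⁻¹' {z}) < ∞ :=
    fun z hz => hs.meas_preimage_singleton_ne_zero (Finset.mem_filter.1 hz).2
  have hmeas : ∀ z ∈ R, Measurable (M (s ⁻¹' {z})) :=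
    fun z hz => hM.measurable _ (s.measurableSet_fiber z) (hfin z hz)
  have hindep : iIndepFun (fun z : R => M (s ⁻¹' {(z : ℂ)})) P :=
    hM.iIndepFun (fun z => s.measurableSet_fiber z) (fun z => hfin z z.2)
      fun z z' hz =>
        Disjoint.preimage _ (Set.disjoint_singleton.2 (Subtype.coe_injective.ne hz))
  have hindep' : iIndepFun (R.restrict fun z ω => z * M (s ⁻¹' {z}) ω) P :=
    hindep.comp (fun z x => (z : ℂ) * x) fun z => by fun_prop
  rw [funext (simpleIntegral_eq_sum_ne_zero M s), ← hR,
    hindep'.charFun_map_fun_finsetSum_eq_prod fun z hz => ((hmeas z hz).const_mul z).aemeasurable,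
    Finset.prod_apply, Finset.prod_congr rfl fun z hz =>
      hM.charFun_const_mul (s.measurableSet_fiber z) (hfin z hz) z w,
    ← Complex.ofReal_prod, ← Real.exp_sum, Finset.sum_neg_distrib, ← Finset.mul_sum,
    lintegral_enorm_rpow_simpleFunc hα, ENNReal.toReal_sum]
  exact fun z hz => ENNReal.mul_ne_top (by finiteness) (hfin z hz).ne

lemma measureReal_abs_inner_gt_le {E : Type*} [NormedAddCommGroup E] [InnerProductSpace ℝ E]
    [MeasurableSpace E] [BorelSpace E] {μ : Measure E} [IsProbabilityMeasure μ] {σ : ℝ}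
    (hσ : 0 ≤ σ) (hα : 0 ≤ α)
    (hchar : ∀ w, charFun μ w = ((Real.exp (-(‖w‖ ^ α * σ)) : ℝ) : ℂ))
    {a : E} (ha : ‖a‖ = 1) {r : ℝ} (hr : 0 < r) :
    μ.real {x | r < |inner ℝ a x|} ≤ 2 * (2 / r) ^ α * σ := by
  have hbound : ‖∫ t in (-2 * r⁻¹)..(2 * r⁻¹), 1 - charFun μ (t • a)‖ ≤
      (2 / r) ^ α * σ * |2 * r⁻¹ - -2 * r⁻¹| := by
    refine intervalIntegral.norm_integral_le_of_norm_le_const fun t ht => ?_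
    have hr' : 0 < r⁻¹ := inv_pos.2 hr
    rw [Set.uIoc_of_le (by linarith)] at ht
    have ht' : |t| ≤ 2 / r := by
      rw [abs_le, div_eq_mul_inv]
      exact ⟨by linarith [ht.1], ht.2⟩
    have hx : 0 ≤ |t| ^ α * σ := by positivity
    rw [hchar, norm_smul, ha, mul_one, Real.norm_eq_abs, ← Complex.ofReal_one,
      ← Complex.ofReal_sub, Complex.norm_real, Real.norm_eq_abs,
      abs_of_nonneg (by linarith [Real.exp_le_one_iff.2 (neg_nonpos.2 hx)])]
    calc 1 - Real.exp (-(|t| ^ α * σ)) ≤ |t| ^ α * σ := by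
          linarith [Real.add_one_le_exp (-(|t| ^ α * σ))]
      _ ≤ (2 / r) ^ α * σ := by gcongr
  calc μ.real {x | r < |inner ℝ a x|}
      ≤ 2⁻¹ * r * ‖∫ t in (-2 * r⁻¹)..(2 * r⁻¹), 1 - charFun μ (t • a)‖ :=
        measureReal_abs_inner_gt_le_integral_charFun hr
    _ ≤ 2⁻¹ * r * ((2 / r) ^ α * σ * |2 * r⁻¹ - -2 * r⁻¹|) := by gcongr
    _ = 2 * (2 / r) ^ α * σ := by
      rw [show 2 * r⁻¹ - -2 * r⁻¹ = 4 * r⁻¹ by ring, abs_of_pos (by positivity)]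
      field_simp
      ring

lemma measureReal_norm_gt_le {μ : Measure ℂ} [IsProbabilityMeasure μ] {σ : ℝ}
    (hσ : 0 ≤ σ) (hα : 0 ≤ α)
    (hchar : ∀ w, charFun μ w = ((Real.exp (-(‖w‖ ^ α * σ)) : ℝ) : ℂ)) {r : ℝ} (hr : 0 < r) :
    μ.real {x | r < ‖x‖} ≤ 4 * (4 / r) ^ α * σ := by
  have hre := measureReal_abs_inner_gt_le hσ hα hchar (a := 1) (by simp) (half_pos hr)
  have him := measureReal_abs_inner_gt_le hσ hα hchar (a := Complex.I) (by simp) (half_pos hr)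
  have hsub : {x : ℂ | r < ‖x‖} ⊆ {x | r / 2 < |inner ℝ (1 : ℂ) x|} ∪
      {x | r / 2 < |inner ℝ Complex.I x|} := by
    intro x hx
    by_contra! hcon
    have := Complex.norm_le_abs_re_add_abs_im x
    simp only [Set.mem_ofPred_eq, Complex.inner, map_one, mul_one, Complex.conj_I, mul_neg,
      Complex.neg_re, Complex.mul_re, Complex.I_re, mul_zero, Complex.I_im, zero_sub, neg_neg,
      Set.mem_union, not_or, not_lt] at hx hcon
    linarith
  rw [show 2 / (r / 2) = 4 / r by field_simp; norm_num] at hre him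
  linarith [(measureReal_mono (μ := μ) hsub).trans (measureReal_union_le _ _)]

lemma lintegral_enorm_rpow_eq {E : Type*} [MeasurableSpace E] {μ : Measure E} (hα : 0 < α)
    (g : E → ℂ) : ∫⁻ x, ‖g x‖ₑ ^ α ∂μ = eLpNorm g (ENNReal.ofReal α) μ ^ α := by
  rw [eLpNorm_eq_lintegral_rpow_enorm_toReal (by simp [hα]) (by simp),
    ENNReal.toReal_ofReal hα.le, ← ENNReal.rpow_mul, one_div_mul_cancel hα.ne', ENNReal.rpow_one]

lemma measure_simpleIntegral_gt_le [IsProbabilityMeasure P]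
    (hM : IsStableRandomMeasure α c M P) (hα : 0 < α)
    {s : SimpleFunc (Fin N → ℝ) ℂ} (hs : s.FinMeasSupp volume) {r : ℝ} (hr : 0 < r) :
    P {ω | r < ‖simpleIntegral M s ω‖} ≤
      ENNReal.ofReal (4 * (4 / r) ^ α * c) * eLpNorm s (ENNReal.ofReal α) volume ^ α := by
  have hX := measurable_simpleIntegral hM hs
  have hc := hM.nonneg
  have hnorm : eLpNorm s (ENNReal.ofReal α) volume ^ α ≠ ∞ :=
    ENNReal.rpow_ne_top_of_nonneg hα.le
      ((SimpleFunc.memLp_iff_finMeasSupp (by simp [hα]) (by simp)).2 hs).eLpNorm_ne_top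
  have : IsProbabilityMeasure (P.map (simpleIntegral M s)) :=
    Measure.isProbabilityMeasure_map hX.aemeasurable
  have htail := measureReal_norm_gt_le (mul_nonneg hc ENNReal.toReal_nonneg) hα.le
    (fun w => by
      rw [charFun_simpleIntegral hM hα hs w, lintegral_enorm_rpow_eq hα, mul_assoc,
        mul_left_comm]) hr
  rw [map_measureReal_apply hX (measurableSet_lt (by fun_prop) (by fun_prop)), ← mul_assoc]
    at htail
  rw [← ENNReal.ofReal_toReal hnorm, ← ENNReal.ofReal_mul (by positivity)]
  exact (ENNReal.le_ofReal_iff_toReal_le (measure_ne_top _ _) (by positivity)).2 htail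

end StableMeasure

section Convergence

variable {Ω ι : Type*} [MeasurableSpace Ω] {P : Measure Ω} {l : Filter ι}

lemma tendstoInMeasure_prodMk {E F : Type*} [PseudoEMetricSpace E] [PseudoEMetricSpace F]
    {X : ι → Ω → E} {X' : Ω → E} {Y : ι → Ω → F} {Y' : Ω → F} (hX : TendstoInMeasure P X l X')
    (hY : TendstoInMeasure P Y l Y') :
    TendstoInMeasure P (fun i ω => (X i ω, Y i ω)) l fun ω => (X' ω, Y' ω) := by
  intro ε hε
  have h := (hX ε hε).add (hY ε hε)
  rw [add_zero] at h
  refine tendsto_of_tendsto_of_tendsto_of_le_of_le tendsto_const_nhds h (fun _ => zero_le)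
    fun i => (measure_mono fun ω hω => ?_).trans (measure_union_le _ _)
  simpa [Prod.edist_eq] using hω

lemma tendstoInMeasure_lipschitzWith_comp {E F : Type*} [PseudoEMetricSpace E]
    [PseudoEMetricSpace F] {X : ι → Ω → E} {Y : Ω → E} {K : NNReal} {g : E → F}
    (hg : LipschitzWith K g) (hX : TendstoInMeasure P X l Y) :
    TendstoInMeasure P (fun i ω => g (X i ω)) l fun ω => g (Y ω) := by
  intro ε hε
  refine tendsto_of_tendsto_of_tendsto_of_le_of_le tendsto_const_nhds
    (hX (ε / K) (ENNReal.div_pos hε.ne' ENNReal.coe_ne_top)) (fun _ => zero_le)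
    fun i => measure_mono fun ω hω => ?_
  exact ENNReal.div_le_of_le_mul' (le_trans hω (hg _ _))

lemma tendstoInMeasure_smul_add_smul {X Y : ι → Ω → ℂ} {X' Y' : Ω → ℂ}
    (hX : TendstoInMeasure P X l X') (hY : TendstoInMeasure P Y l Y') (a b : ℂ) :
    TendstoInMeasure P (fun i => a • X i + b • Y i) l (a • X' + b • Y') := by
  set L : ℂ × ℂ →L[ℂ] ℂ :=
    a • ContinuousLinearMap.fst ℂ ℂ ℂ + b • ContinuousLinearMap.snd ℂ ℂ ℂ
  have h := tendstoInMeasure_lipschitzWith_comp L.lipschitz (tendstoInMeasure_prodMk hX hY)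
  have hL : ∀ z, L z = a * z.1 + b * z.2 := fun z => rfl
  simp only [hL] at h
  exact h

lemma tendsto_eLpNorm_smul_add_smul_zero {f g : ι → Ω → ℂ} {p : ℝ≥0∞}
    (hf : ∀ i, AEStronglyMeasurable (f i) P) (hg : ∀ i, AEStronglyMeasurable (g i) P)
    (hf0 : Tendsto (fun i => eLpNorm (f i) p P) l (𝓝 0))
    (hg0 : Tendsto (fun i => eLpNorm (g i) p P) l (𝓝 0)) (a b : ℂ) :
    Tendsto (fun i => eLpNorm (a • f i + b • g i) p P) l (𝓝 0) := by
  have hsum := (ENNReal.Tendsto.const_mul hf0 (Or.inr (enorm_ne_top (x := a)))).add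
    (ENNReal.Tendsto.const_mul hg0 (Or.inr (enorm_ne_top (x := b))))
  have hbound := ENNReal.Tendsto.const_mul hsum (Or.inr (ENNReal.LpAddConst_lt_top p).ne)
  rw [mul_zero, mul_zero, add_zero, mul_zero] at hbound
  refine tendsto_of_tendsto_of_tendsto_of_le_of_le tendsto_const_nhds hbound (fun _ => zero_le)
    fun i => ?_
  rw [← eLpNorm_const_smul, ← eLpNorm_const_smul]
  exact eLpNorm_add_le' ((hf i).const_smul a) ((hg i).const_smul b) p

lemma tendsto_eLpNorm_sub_prod {f : ℕ → Ω → ℂ} {g : Ω → ℂ} {p : ℝ≥0∞}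
    (hf : ∀ n, AEStronglyMeasurable (f n - g) P)
    (hlim : Tendsto (fun n => eLpNorm (f n - g) p P) atTop (𝓝 0)) :
    Tendsto (fun q : ℕ × ℕ => eLpNorm (f q.1 - f q.2) p P) atTop (𝓝 0) := by
  rw [← prod_atTop_atTop_eq]
  have h := tendsto_eLpNorm_smul_add_smul_zero (fun q : ℕ × ℕ => hf q.1) (fun q => hf q.2)
    (hlim.comp tendsto_fst) (hlim.comp tendsto_snd) 1 (-1)
  refine h.congr fun q => ?_
  congr 1
  simp

lemma tendsto_const_mul_rpow_zero {u : ι → ℝ≥0∞} (hu : Tendsto u l (𝓝 0)) {α : ℝ} (hα : 0 < α)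
    {C : ℝ≥0∞} (hC : C ≠ ∞) : Tendsto (fun i => C * u i ^ α) l (𝓝 0) := by
  simpa [hα] using ENNReal.Tendsto.const_mul (hu.ennrpow_const α) (Or.inr hC)

lemma ae_exists_tendsto_of_tsum_measure_ne_top {E : Type*} [PseudoMetricSpace E] [CompleteSpace E]
    {X : ℕ → Ω → E} {u : ℕ → ℝ} (hu : Summable u)
    (h : ∑' k, P {ω | u k < dist (X (k + 1) ω) (X k ω)} ≠ ∞) :
    ∀ᵐ ω ∂P, ∃ x, Tendsto (fun k => X k ω) atTop (𝓝 x) := by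
  filter_upwards [ae_eventually_notMem h] with ω hω
  refine cauchySeq_tendsto_of_complete (cauchySeq_of_summable_dist ?_)
  refine Summable.of_norm_bounded_eventually_nat hu ?_
  filter_upwards [hω] with k hk
  rw [Real.norm_of_nonneg dist_nonneg, dist_comm]
  exact not_lt.1 hk

lemma exists_seq_ae_tendsto_of_cauchy_in_measure {E : Type*} [PseudoMetricSpace E]
    [CompleteSpace E] {X : ℕ → Ω → E}
    (h : ∀ r > 0, Tendsto (fun q : ℕ × ℕ => P {ω | r < dist (X q.1 ω) (X q.2 ω)}) atTop (𝓝 0)) :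
    ∃ φ : ℕ → ℕ, StrictMono φ ∧ ∀ᵐ ω ∂P, ∃ x, Tendsto (fun k => X (φ k) ω) atTop (𝓝 x) := by
  have hsmall : ∀ k : ℕ, ∀ᶠ m in atTop, ∀ n ≥ m,
      P {ω | (1 / 2 : ℝ) ^ k < dist (X n ω) (X m ω)} ≤ ENNReal.ofReal ((1 / 2) ^ k) := by
    intro k
    have hk := (h ((1 / 2) ^ k) (by positivity)).eventually_le_const
      (u := ENNReal.ofReal ((1 / 2 : ℝ) ^ k)) (by simp)
    obtain ⟨⟨a, b⟩, hab⟩ := eventually_atTop.1 hk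
    filter_upwards [eventually_ge_atTop (max a b)] with m hm n hn
    exact hab (n, m) ⟨(le_max_left a b).trans (hm.trans hn), (le_max_right a b).trans hm⟩
  obtain ⟨φ, hφ, hφ'⟩ := extraction_forall_of_eventually hsmall
  refine ⟨φ, hφ, ae_exists_tendsto_of_tsum_measure_ne_top summable_geometric_two ?_⟩
  refine ne_top_of_le_ne_top ?_
    (ENNReal.tsum_le_tsum fun k => hφ' k _ (hφ.monotone k.le_succ))
  rw [← ENNReal.ofReal_tsum_of_nonneg (fun _ => by positivity) summable_geometric_two]
  exact ENNReal.ofReal_ne_top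

end Convergence

section StableIntegral

variable {N : ℕ} {Ω : Type*} [MeasurableSpace Ω] {P : Measure Ω} {α c : ℝ}
  {M : Set (Fin N → ℝ) → Ω → ℂ} {f g : (Fin N → ℝ) → ℂ} {X Y : Ω → ℂ}

lemma exists_simpleFunc_tendsto_eLpNorm (hα : 0 < α) (hf : MemLp f (ENNReal.ofReal α) volume) :
    ∃ s : ℕ → SimpleFunc (Fin N → ℝ) ℂ, (∀ n, (s n).FinMeasSupp volume) ∧
      Tendsto (fun n => eLpNorm (⇑(s n) - f) (ENNReal.ofReal α) volume) atTop (𝓝 0) := by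
  have happrox : ∀ n : ℕ, ∃ s : SimpleFunc (Fin N → ℝ) ℂ, s.FinMeasSupp volume ∧
      eLpNorm (⇑s - f) (ENNReal.ofReal α) volume ≤ (n : ℝ≥0∞)⁻¹ := by
    intro n
    obtain ⟨s, hs, hs'⟩ := hf.exists_simpleFunc_eLpNorm_sub_lt (by simp)
      (ε := (n : ℝ≥0∞)⁻¹) (by simp)
    rw [eLpNorm_sub_comm] at hs
    exact ⟨s, (SimpleFunc.memLp_iff_finMeasSupp (by simp [hα]) (by simp)).1 hs', hs.le⟩
  choose s hs hsle using happrox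
  exact ⟨s, hs, tendsto_of_tendsto_of_tendsto_of_le_of_le tendsto_const_nhds
    ENNReal.tendsto_inv_nat_nhds_zero (fun _ => zero_le) hsle⟩

lemma tendsto_measure_dist_simpleIntegral [IsProbabilityMeasure P]
    (hM : IsStableRandomMeasure α c M P) (hα : 0 < α) {s : ℕ → SimpleFunc (Fin N → ℝ) ℂ}
    (hs : ∀ n, (s n).FinMeasSupp volume)
    (hcauchy : Tendsto (fun q : ℕ × ℕ => eLpNorm (⇑(s q.1) - ⇑(s q.2)) (ENNReal.ofReal α) volume)
      atTop (𝓝 0)) {r : ℝ} (hr : 0 < r) :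
    Tendsto (fun q : ℕ × ℕ =>
      P {ω | r < dist (simpleIntegral M (s q.1) ω) (simpleIntegral M (s q.2) ω)}) atTop (𝓝 0) := by
  refine tendsto_of_tendsto_of_tendsto_of_le_of_le tendsto_const_nhds
    (tendsto_const_mul_rpow_zero hcauchy hα (C := ENNReal.ofReal (4 * (4 / r) ^ α * c))
      ENNReal.ofReal_ne_top) (fun _ => zero_le) fun q => ?_
  refine le_trans (measure_mono_ae ?_)
    (measure_simpleIntegral_gt_le hM hα (finMeasSupp_sub (hs q.1) (hs q.2)) hr)
  filter_upwards [simpleIntegral_sub hM (hs q.1) (hs q.2)] with ω hω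
    (hlt : r < dist (simpleIntegral M (s q.1) ω) (simpleIntegral M (s q.2) ω))
  change r < ‖simpleIntegral M (s q.1 - s q.2) ω‖
  rwa [hω, Pi.sub_apply, ← dist_eq_norm]

lemma exists_isStableIntegral [IsProbabilityMeasure P] (hM : IsStableRandomMeasure α c M P)
    (hα : 0 < α) (hf : MemLp f (ENNReal.ofReal α) volume) : ∃ X, IsStableIntegral α M P f X := by
  obtain ⟨s, hs, hlim⟩ := exists_simpleFunc_tendsto_eLpNorm hα hf
  have hcauchy := tendsto_eLpNorm_sub_prod (fun n => (s n).aestronglyMeasurable.sub hf.1) hlim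
  obtain ⟨φ, hφ, hconv⟩ := exists_seq_ae_tendsto_of_cauchy_in_measure (P := P)
    (X := fun n => simpleIntegral M (s n))
    fun r hr => tendsto_measure_dist_simpleIntegral hM hα hs hcauchy hr
  obtain ⟨X, hX, hXlim⟩ := measurable_limit_of_tendsto_metrizable_ae
    (fun k => (measurable_simpleIntegral hM (hs (φ k))).aemeasurable) hconv
  exact ⟨X, hf, hX, fun k => s (φ k), fun k => hs _, hlim.comp hφ.tendsto_atTop,
    tendstoInMeasure_of_tendsto_ae
      (fun k => (measurable_simpleIntegral hM (hs (φ k))).aestronglyMeasurable) hXlim⟩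

lemma isStableIntegral_stableIntegral [IsProbabilityMeasure P]
    (hM : IsStableRandomMeasure α c M P) (hα : 0 < α) (hf : MemLp f (ENNReal.ofReal α) volume) :
    IsStableIntegral α M P f (stableIntegral α M P f) := by
  have h := exists_isStableIntegral hM hα hf
  rw [stableIntegral, dif_pos h]
  exact h.choose_spec

lemma IsStableIntegral.smul_add_smul (hM : IsStableRandomMeasure α c M P)
    (hX : IsStableIntegral α M P f X) (hY : IsStableIntegral α M P g Y) (a b : ℂ) :
    IsStableIntegral α M P (a • f + b • g) (a • X + b • Y) := by
  obtain ⟨hf, hXm, s, hs, hsf, hsX⟩ := hX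
  obtain ⟨hg, hYm, t, ht, htg, htY⟩ := hY
  refine ⟨(hf.const_smul a).add (hg.const_smul b), (hXm.const_smul a).add (hYm.const_smul b),
    fun n => a • s n + b • t n,
    fun n => finMeasSupp_smul_add_smul (hs n) (ht n) a b, ?_, ?_⟩
  · refine (tendsto_eLpNorm_smul_add_smul_zero (fun n => (s n).aestronglyMeasurable.sub hf.1)
      (fun n => (t n).aestronglyMeasurable.sub hg.1) hsf htg a b).congr fun n => ?_
    congr 1
    ext x
    simp only [Pi.add_apply, Pi.smul_apply, Pi.sub_apply, smul_eq_mul, SimpleFunc.coe_add,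
      SimpleFunc.coe_smul]
    ring
  · exact (tendstoInMeasure_smul_add_smul hsX htY a b).congr_left
      fun n => (simpleIntegral_smul_add_smul hM (hs n) (ht n) a b).symm

lemma IsStableIntegral.sub (hM : IsStableRandomMeasure α c M P)
    (hX : IsStableIntegral α M P f X) (hY : IsStableIntegral α M P g Y) :
    IsStableIntegral α M P (f - g) (X - Y) := by
  simpa [sub_eq_add_neg] using hX.smul_add_smul hM hY 1 (-1)

lemma isStableIntegral_zero : IsStableIntegral α M P 0 0 := by
  refine ⟨MemLp.zero, measurable_const, fun _ => 0,
    fun _ => SimpleFunc.finMeasSupp_iff_support.2 (by simp), by simp, ?_⟩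
  simp only [simpleIntegral_zero]
  exact fun ε hε => by simp [hε.ne']

lemma IsStableIntegral.sum_const_mul (hM : IsStableRandomMeasure α c M P) {ι : Type*}
    (D : Finset ι) {F : ι → (Fin N → ℝ) → ℂ} {Z : ι → Ω → ℂ}
    (hZ : ∀ i, IsStableIntegral α M P (F i) (Z i)) (a : ι → ℂ) :
    IsStableIntegral α M P (fun x => ∑ i ∈ D, a i * F i x) fun ω => ∑ i ∈ D, a i * Z i ω := by
  classical
  induction D using Finset.induction_on with
  | empty => exact isStableIntegral_zero
  | insert i D hi ih =>
    simpa [Finset.sum_insert hi, Pi.add_def] using (hZ i).smul_add_smul hM ih (a i) 1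

lemma IsStableIntegral.measure_ge_le [IsProbabilityMeasure P]
    (hM : IsStableRandomMeasure α c M P) (hα : 0 < α) (hX : IsStableIntegral α M P f X)
    {r : ℝ} (hr : 0 < r) :
    P {ω | r ≤ ‖X ω‖} ≤ ENNReal.ofReal (4 * (4 / (r / 2)) ^ α * c) *
      (ENNReal.LpAddConst (ENNReal.ofReal α) * eLpNorm f (ENNReal.ofReal α) volume) ^ α := by
  obtain ⟨hf, -, s, hs, hsf, hsX⟩ := hX
  rw [tendstoInMeasure_iff_norm] at hsX
  set K := ENNReal.LpAddConst (ENNReal.ofReal α)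
  set C := ENNReal.ofReal (4 * (4 / (r / 2)) ^ α * c) with hC
  have hlim : Tendsto (fun n => P {ω | r / 2 ≤ ‖simpleIntegral M (s n) ω - X ω‖} +
      C * (K * (eLpNorm (⇑(s n) - f) (ENNReal.ofReal α) volume +
        eLpNorm f (ENNReal.ofReal α) volume)) ^ α) atTop
      (𝓝 (0 + C * (K * (0 + eLpNorm f (ENNReal.ofReal α) volume)) ^ α)) :=
    (hsX _ (half_pos hr)).add <| ENNReal.Tendsto.const_mul
      ((ENNReal.Tendsto.const_mul (hsf.add tendsto_const_nhds)
        (Or.inr (ENNReal.LpAddConst_lt_top _).ne)).ennrpow_const α) (Or.inr ENNReal.ofReal_ne_top)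
  rw [zero_add, zero_add] at hlim
  refine ge_of_tendsto' hlim fun n => ?_
  have hsub : {ω | r ≤ ‖X ω‖} ⊆ {ω | r / 2 ≤ ‖simpleIntegral M (s n) ω - X ω‖} ∪
      {ω | r / 2 < ‖simpleIntegral M (s n) ω‖} := by
    intro ω hω
    by_contra! hcon
    simp only [Set.mem_union, Set.mem_ofPred_eq, not_or, not_le, not_lt] at hω hcon
    linarith [norm_le_norm_add_norm_sub (simpleIntegral M (s n) ω) (X ω), hcon.1, hcon.2]
  refine (measure_mono hsub).trans ((measure_union_le _ _).trans ?_)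
  gcongr
  refine (measure_simpleIntegral_gt_le hM hα (hs n) (half_pos hr)).trans ?_
  rw [← hC]
  gcongr
  simpa using eLpNorm_add_le' ((s n).aestronglyMeasurable.sub hf.1) hf.1 (ENNReal.ofReal α)

lemma IsStableIntegral.tendstoInMeasure [IsProbabilityMeasure P]
    (hM : IsStableRandomMeasure α c M P) (hα : 0 < α) {ι : Type*} {l : Filter ι}
    {F : ι → (Fin N → ℝ) → ℂ} {Z : ι → Ω → ℂ} (hZ : ∀ i, IsStableIntegral α M P (F i) (Z i))
    (hY : IsStableIntegral α M P g Y)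
    (hFg : Tendsto (fun i => eLpNorm (F i - g) (ENNReal.ofReal α) volume) l (𝓝 0)) :
    TendstoInMeasure P Z l Y := by
  rw [tendstoInMeasure_iff_norm]
  intro r hr
  have hK := ENNReal.Tendsto.const_mul hFg
    (Or.inr (ENNReal.LpAddConst_lt_top (ENNReal.ofReal α)).ne)
  rw [mul_zero] at hK
  exact tendsto_of_tendsto_of_tendsto_of_le_of_le tendsto_const_nhds
    (tendsto_const_mul_rpow_zero hK hα ENNReal.ofReal_ne_top) (fun _ => zero_le)
    fun i => ((hZ i).sub hM hY).measure_ge_le hM hα hr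

end StableIntegral

section Wavelet

lemma exists_schwartz_comp_mul (f : 𝓢(ℝ, ℂ)) {a : ℝ} (ha : a ≠ 0) :
    ∃ g : 𝓢(ℝ, ℂ), ∀ x, g x = f (a * x) :=
  ⟨SchwartzMap.compCLMOfContinuousLinearEquiv ℂ
    (ContinuousLinearEquiv.unitsEquivAut ℝ (Units.mk0 a ha)) f, fun x => by simp [mul_comm]⟩

lemma exists_schwartz_psiJK (ψ : 𝓢(ℝ, ℝ)) (j k : ℤ) :
    ∃ φ : 𝓢(ℝ, ℂ), ∀ x, φ x = psiJK ψ j k x := by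
  obtain ⟨g, hg⟩ := exists_schwartz_comp_mul
    ((SchwartzMap.postcompCLM Complex.ofRealCLM ψ).compSubConstCLM ℂ (k : ℝ))
    (a := (2 : ℝ) ^ j) (by positivity)
  refine ⟨(((2 : ℝ) ^ ((j : ℝ) / 2) : ℝ) : ℂ) • g, fun x => ?_⟩
  simp [hg, psiJK]

lemma fourierHat_eq_fourier (g : ℝ → ℂ) (ξ : ℝ) :
    fourierHat g ξ = (((2 * Real.pi) ^ (-(1 / 2 : ℝ)) : ℝ) : ℂ) *
      FourierTransform.fourier g ((2 * Real.pi)⁻¹ * ξ) := by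
  rw [fourierHat, Real.fourier_real_eq_integral_exp_smul]
  congr 1
  refine integral_congr_ae (Eventually.of_forall fun s => ?_)
  simp only [smul_eq_mul]
  congr 2
  have : (Real.pi : ℂ) ≠ 0 := by exact_mod_cast Real.pi_ne_zero
  push_cast
  field_simp

lemma exists_schwartz_fourierHat (φ : 𝓢(ℝ, ℂ)) :
    ∃ g : 𝓢(ℝ, ℂ), ∀ ξ, g ξ = fourierHat φ ξ := by
  obtain ⟨g, hg⟩ := exists_schwartz_comp_mul (FourierTransform.fourier φ)
    (a := (2 * Real.pi)⁻¹) (by positivity)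
  refine ⟨(((2 * Real.pi) ^ (-(1 / 2 : ℝ)) : ℝ) : ℂ) • g, fun ξ => ?_⟩
  rw [fourierHat_eq_fourier, smul_apply, hg, smul_eq_mul, SchwartzMap.fourier_coe]

lemma exists_schwartz_fourierHat_ofReal (ψ : 𝓢(ℝ, ℝ)) :
    ∃ g : 𝓢(ℝ, ℂ), ∀ ξ, g ξ = fourierHat (fun x => (ψ x : ℂ)) ξ :=
  exists_schwartz_fourierHat (SchwartzMap.postcompCLM Complex.ofRealCLM ψ)

lemma exists_schwartz_psiHat (α : ℝ) (ψ : 𝓢(ℝ, ℝ)) (j k : ℤ) :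
    ∃ g : 𝓢(ℝ, ℂ), ∀ ξ, g ξ = psiHat α ψ j k ξ := by
  obtain ⟨φ, hφ⟩ := exists_schwartz_psiJK ψ j k
  obtain ⟨g, hg⟩ := exists_schwartz_fourierHat φ
  refine ⟨(((2 : ℝ) ^ (-((j : ℝ) * (1 / α - 1 / 2))) : ℝ) : ℂ) • g, fun ξ => ?_⟩
  rw [smul_apply, smul_eq_mul, hg, psiHat, funext hφ]

lemma fourierHat_comp_mul_sub (g : ℝ → ℂ) {a : ℝ} (ha : 0 < a) (b ξ : ℝ) :
    fourierHat (fun x => g (a * x - b)) ξ = ((a⁻¹ : ℝ) : ℂ) *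
      Complex.exp (-(Complex.I * (b : ℂ) * ((a⁻¹ * ξ : ℝ) : ℂ))) * fourierHat g (a⁻¹ * ξ) := by
  set G : ℝ → ℂ := fun u => Complex.exp (-(Complex.I * (b : ℂ) * ((a⁻¹ * ξ : ℝ) : ℂ))) *
    (Complex.exp (-(Complex.I * (u : ℂ) * ((a⁻¹ * ξ : ℝ) : ℂ))) * g u) with hG
  have integrand_eq (s : ℝ) :
      Complex.exp (-(Complex.I * (s : ℂ) * (ξ : ℂ))) * g (a * s - b) = G (a * s - b) := by
    simp only [hG]
    rw [← mul_assoc, ← Complex.exp_add]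
    have : (a : ℂ) ≠ 0 := by exact_mod_cast ha.ne'
    congr 2
    push_cast
    field_simp
    ring
  have change_of_variables : ∫ s : ℝ, G (a * s - b) = ((a⁻¹ : ℝ) : ℂ) * ∫ u, G u := by
    rw [Measure.integral_comp_mul_left (fun u => G (u - b)), integral_sub_right_eq_self,
      abs_of_pos (inv_pos.2 ha), Complex.real_smul]
  rw [fourierHat, fourierHat, integral_congr_ae (Eventually.of_forall integrand_eq),
    change_of_variables, integral_const_mul]
  ring

lemma fourierHat_const_mul (c : ℂ) (g : ℝ → ℂ) (ξ : ℝ) :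
    fourierHat (fun x => c * g x) ξ = c * fourierHat g ξ := by
  simp only [fourierHat, mul_left_comm _ c, integral_const_mul]

lemma fourierHat_psiJK (ψ : ℝ → ℝ) (j k : ℤ) (ξ : ℝ) :
    fourierHat (psiJK ψ j k) ξ = (((2 : ℝ) ^ (-((j : ℝ) / 2)) : ℝ) : ℂ) *
      Complex.exp (-(Complex.I * (k : ℂ) * (((2 : ℝ) ^ (-j) * ξ : ℝ) : ℂ))) *
      fourierHat (fun x => (ψ x : ℂ)) ((2 : ℝ) ^ (-j) * ξ) := by
  have hpsiJK : psiJK ψ j k = fun x => (((2 : ℝ) ^ ((j : ℝ) / 2) : ℝ) : ℂ) *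
      (ψ ((2 : ℝ) ^ j * x - (k : ℝ)) : ℂ) := by
    funext x
    rw [psiJK, Complex.ofReal_mul]
  have hpow : (2 : ℝ) ^ (-((j : ℝ) / 2)) = (2 : ℝ) ^ ((j : ℝ) / 2) * ((2 : ℝ) ^ j)⁻¹ := by
    rw [← Real.rpow_intCast, ← Real.rpow_neg (by norm_num), ← Real.rpow_add (by norm_num)]
    congr 1
    ring
  rw [hpsiJK, fourierHat_const_mul,
    fourierHat_comp_mul_sub (fun x => (ψ x : ℂ)) (by positivity : (0 : ℝ) < 2 ^ j), hpow, zpow_neg,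
    Complex.ofReal_mul _ ((2 : ℝ) ^ j)⁻¹, Complex.ofReal_intCast]
  simp only [mul_assoc]

lemma norm_psiHat (α : ℝ) (ψ : ℝ → ℝ) (j k : ℤ) (ξ : ℝ) :
    ‖psiHat α ψ j k ξ‖ = (2 : ℝ) ^ (-((j : ℝ) * (1 / α))) *
      ‖fourierHat (fun x => (ψ x : ℂ)) ((2 : ℝ) ^ (-j) * ξ)‖ := by
  have hexp : ‖Complex.exp (-(Complex.I * (k : ℂ) * (((2 : ℝ) ^ (-j) * ξ : ℝ) : ℂ)))‖ = 1 := by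
    rw [show -(Complex.I * (k : ℂ) * (((2 : ℝ) ^ (-j) * ξ : ℝ) : ℂ)) =
      Complex.I * ((-(k * ((2 : ℝ) ^ (-j) * ξ)) : ℝ) : ℂ) by push_cast; ring,
      Complex.norm_exp_I_mul_ofReal]
  rw [psiHat, fourierHat_psiJK, norm_mul, norm_mul, norm_mul, Complex.norm_real, Complex.norm_real,
    Real.norm_of_nonneg (by positivity), Real.norm_of_nonneg (by positivity), hexp, mul_one,
    ← mul_assoc, ← Real.rpow_add (by norm_num)]
  congr 2
  ring

lemma contDiff_div_abs_rpow {g : ℝ → ℂ} {n : ℕ∞} (hg : ContDiff ℝ n g)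
    (h0 : (0 : ℝ) ∉ tsupport g) (a : ℝ) :
    ContDiff ℝ n fun η => g η / ((|η| ^ a : ℝ) : ℂ) := by
  simp only [div_eq_mul_inv, ← Complex.ofReal_inv, ← Real.rpow_neg (abs_nonneg _)]
  refine contDiff_iff_contDiffAt.2 fun x => ?_
  by_cases hx : x ∈ tsupport g
  swap
  · refine contDiffAt_const (c := 0) |>.congr_of_eventuallyEq ?_
    filter_upwards [notMem_tsupport_iff_eventuallyEq.1 hx] with η hη
    rw [hη, Pi.zero_apply, zero_mul]
  have hx0 : x ≠ 0 := ne_of_mem_of_not_mem hx h0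
  exact hg.contDiffAt.mul (Complex.ofRealCLM.contDiff.contDiffAt.comp x
    ((contDiffAt_abs hx0).rpow_const_of_ne (abs_ne_zero.2 hx0)))

lemma IsLemarieMeyer.exists_schwartz_div_abs_rpow {ψ : 𝓢(ℝ, ℝ)} (hψ : IsLemarieMeyer ψ) (a : ℝ) :
    ∃ g : 𝓢(ℝ, ℂ), ∀ η, g η = fourierHat (fun x => (ψ x : ℂ)) η / ((|η| ^ a : ℝ) : ℂ) := by
  obtain ⟨g, hg⟩ := exists_schwartz_fourierHat_ofReal ψ
  have hsupport := hψ.support_hat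
  rw [← funext hg] at hsupport
  have hcompact : HasCompactSupport g :=
    (isCompact_Icc (a := -(8 * Real.pi / 3)) (b := 8 * Real.pi / 3)).of_isClosed_subset
      (isClosed_tsupport _) fun ξ hξ => abs_le.1 (hsupport hξ).2
  have hzero : (0 : ℝ) ∉ tsupport g := fun h => by
    have := (hsupport h).1
    rw [abs_zero] at this
    linarith [Real.pi_pos]
  have hquot : HasCompactSupport fun η => g η / ((|η| ^ a : ℝ) : ℂ) := by
    simp only [div_eq_mul_inv]
    exact hcompact.mul_right
  exact ⟨hquot.toSchwartzMap (contDiff_div_abs_rpow (g.smooth ⊤) hzero a),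
    fun η => congrArg (· / ((|η| ^ a : ℝ) : ℂ)) (hg η)⟩

lemma IsLemarieMeyer.exists_schwartz_psiFrac {ψ : 𝓢(ℝ, ℝ)} (hψ : IsLemarieMeyer ψ) (α v : ℝ) :
    ∃ Θ : 𝓢(ℝ, ℂ), ∀ y, Θ y = psiFrac α ψ v y := by
  obtain ⟨g, hg⟩ := hψ.exists_schwartz_div_abs_rpow (v + 1 / α)
  obtain ⟨Θ, hΘ⟩ := exists_schwartz_comp_mul (FourierTransformInv.fourierInv g)
    (a := (2 * Real.pi)⁻¹) (by positivity)
  refine ⟨Θ, fun y => ?_⟩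
  rw [hΘ, SchwartzMap.fourierInv_coe, Real.fourierInv_eq', psiFrac]
  refine integral_congr_ae (Eventually.of_forall fun η => ?_)
  simp only [smul_eq_mul, hg]
  congr 2
  have : (Real.pi : ℂ) ≠ 0 := by exact_mod_cast Real.pi_ne_zero
  simp only [RCLike.inner_apply, conj_trivial]
  push_cast
  field_simp

lemma IsLemarieMeyer.psiFrac_sub_psiFrac {ψ : 𝓢(ℝ, ℝ)} (hψ : IsLemarieMeyer ψ) (α v y b : ℝ) :
    psiFrac α ψ v (y - b) - psiFrac α ψ v (-b) =
      ∫ η : ℝ, fKer α v y η * (Complex.exp (-(Complex.I * (b : ℂ) * (η : ℂ))) *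
        fourierHat (fun x => (ψ x : ℂ)) η) := by
  obtain ⟨g, hg⟩ := hψ.exists_schwartz_div_abs_rpow (v + 1 / α)
  have hint (u : ℝ) :
      Integrable (fun η : ℝ => Complex.exp (Complex.I * (u : ℂ) * (η : ℂ)) * g η) := by
    refine (g.integrable (μ := volume)).bdd_mul (c := 1) (by fun_prop)
      (Eventually.of_forall fun η => ?_)
    rw [mul_assoc, ← Complex.ofReal_mul, Complex.norm_exp_I_mul_ofReal]
  simp only [psiFrac, ← hg]
  rw [← integral_sub (hint _) (hint _)]
  refine integral_congr_ae (Eventually.of_forall fun η => ?_)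
  have hexp : Complex.exp (Complex.I * ((y - b : ℝ) : ℂ) * (η : ℂ)) =
      Complex.exp (Complex.I * (y : ℂ) * (η : ℂ)) *
        Complex.exp (-(Complex.I * (b : ℂ) * (η : ℂ))) := by
    rw [← Complex.exp_add]
    congr 1
    push_cast
    ring
  have hexp_neg : Complex.I * ((-b : ℝ) : ℂ) * (η : ℂ) = -(Complex.I * (b : ℂ) * (η : ℂ)) := by
    push_cast
    ring
  simp only [hg, hexp, hexp_neg, fKer]
  ring

lemma fKer_mul (α v x : ℝ) {c : ℝ} (hc : 0 < c) (η : ℝ) :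
    fKer α v x (c * η) = ((c ^ (-(v + 1 / α)) : ℝ) : ℂ) * fKer α v (c * x) η := by
  rw [fKer, fKer, abs_mul, abs_of_pos hc, Real.mul_rpow hc.le (abs_nonneg _), Real.rpow_neg hc.le]
  push_cast
  rw [show Complex.I * (x : ℂ) * ((c : ℂ) * (η : ℂ)) = Complex.I * ((c : ℂ) * (x : ℂ)) * (η : ℂ) by
    ring]
  field_simp

lemma integral_eq_mul_integral_comp_mul (f : ℝ → ℂ) {c : ℝ} (hc : 0 < c) :
    ∫ x, f x = (c : ℂ) * ∫ x, f (c * x) := by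
  rw [Measure.integral_comp_mul_left, abs_of_pos (inv_pos.2 hc), Complex.real_smul, ← mul_assoc,
    ← Complex.ofReal_mul, mul_inv_cancel₀ hc.ne', Complex.ofReal_one, one_mul]

lemma IsLemarieMeyer.wCoeff_eq {ψ : 𝓢(ℝ, ℝ)} (hψ : IsLemarieMeyer ψ) (α v : ℝ) (j k : ℤ)
    (x : ℝ) : wCoeff α ψ v j k x = (((2 : ℝ) ^ (-((j : ℝ) * v)) : ℝ) : ℂ) *
      (psiFrac α ψ v ((2 : ℝ) ^ j * x - k) - psiFrac α ψ v (-(k : ℝ))) := by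
  have h2 : (0 : ℝ) < 2 ^ j := by positivity
  have integrand_eq (η : ℝ) :
      fKer α v x ((2 : ℝ) ^ j * η) * fourierHat (psiJK ψ j k) ((2 : ℝ) ^ j * η) =
        (((2 : ℝ) ^ (j * (-(v + 1 / α))) * (2 : ℝ) ^ (-((j : ℝ) / 2)) : ℝ) : ℂ) *
          (fKer α v ((2 : ℝ) ^ j * x) η * (Complex.exp (-(Complex.I * ((k : ℝ) : ℂ) * (η : ℂ))) *
            fourierHat (fun x => (ψ x : ℂ)) η)) := by
    rw [fKer_mul α v x h2, fourierHat_psiJK, zpow_neg, inv_mul_cancel_left₀ h2.ne',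
      ← Real.rpow_intCast, ← Real.rpow_mul (by norm_num), Complex.ofReal_mul,
      Complex.ofReal_intCast]
    ring
  rw [wCoeff, integral_eq_mul_integral_comp_mul _ h2,
    integral_congr_ae (Eventually.of_forall integrand_eq), integral_const_mul,
    ← hψ.psiFrac_sub_psiFrac, ← mul_assoc, ← mul_assoc, ← Complex.ofReal_mul, ← Complex.ofReal_mul]
  congr 2
  rw [← Real.rpow_intCast, ← Real.rpow_add (by norm_num), ← Real.rpow_add (by norm_num),
    ← Real.rpow_add (by norm_num)]
  congr 1
  ring

/-- The frequency band `2^j · (2π/3) ≤ |ξ| ≤ 2^j · (8π/3)` carrying the Fourier transforms of the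
wavelets `ψ_{j,k}` of scale `j`. -/
def waveletBand (j : ℤ) : Set ℝ :=
  {ξ | 2 ^ j * (2 * Real.pi / 3) ≤ |ξ| ∧ |ξ| ≤ 2 ^ j * (8 * Real.pi / 3)}

lemma IsLemarieMeyer.mem_waveletBand {ψ : 𝓢(ℝ, ℝ)} (hψ : IsLemarieMeyer ψ) {α ξ : ℝ} {j k : ℤ}
    (h : psiHat α ψ j k ξ ≠ 0) : ξ ∈ waveletBand j := by
  have h2 : (0 : ℝ) < 2 ^ j := by positivity
  have hne : fourierHat (fun x => (ψ x : ℂ)) ((2 : ℝ) ^ (-j) * ξ) ≠ 0 := by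
    rw [← norm_ne_zero_iff, norm_psiHat] at h
    exact norm_ne_zero_iff.1 (right_ne_zero_of_mul h)
  obtain ⟨hlo, hhi⟩ := hψ.support_hat (subset_tsupport _ hne)
  rw [abs_mul, zpow_neg, abs_of_pos (inv_pos.2 h2), inv_mul_eq_div] at hlo hhi
  exact ⟨(le_div_iff₀' h2).1 hlo, (div_le_iff₀' h2).1 hhi⟩

lemma le_add_two_of_mem_waveletBand {i j : ℤ} {ξ : ℝ} (hi : ξ ∈ waveletBand i)
    (hj : ξ ∈ waveletBand j) : j ≤ i + 2 := by
  have h : (2 : ℝ) ^ j ≤ 2 ^ (i + 2) := by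
    rw [zpow_add₀ two_ne_zero, ← mul_le_mul_iff_of_pos_right (by positivity : 0 < 2 * Real.pi / 3)]
    linarith [hi.2, hj.1]
  exact (zpow_le_zpow_iff_right₀ one_lt_two).1 h

end Wavelet

section Domination

/-- The profile `(1 + |x|)⁻²`, which controls the wavelets and can be summed over integer
translations. -/
def quadDecay (x : ℝ) : ℝ := ((1 + |x|) ^ 2)⁻¹

lemma quadDecay_nonneg (x : ℝ) : 0 ≤ quadDecay x := by unfold quadDecay; positivity

lemma quadDecay_le_one (x : ℝ) : quadDecay x ≤ 1 :=
  inv_le_one_of_one_le₀ (one_le_pow₀ (by linarith [abs_nonneg x]))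

lemma quadDecay_le_four_mul {x y : ℝ} (h : |x - y| ≤ 1) : quadDecay x ≤ 4 * quadDecay y := by
  have hxy : 1 + |y| ≤ 2 * (1 + |x|) := by
    linarith [abs_sub_abs_le_abs_sub y x, abs_sub_comm x y, abs_nonneg x]
  unfold quadDecay
  rw [← div_eq_mul_inv, inv_eq_one_div, div_le_div_iff₀ (by positivity) (by positivity)]
  nlinarith [pow_le_pow_left₀ (by positivity) hxy 2]

lemma exists_norm_schwartz_le (Θ : 𝓢(ℝ, ℂ)) :
    ∃ C : ℝ, 0 ≤ C ∧ ∀ x, ‖Θ x‖ ≤ C * quadDecay x := by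
  refine ⟨2 ^ 2 * (Finset.Iic ((2, 0) : ℕ × ℕ)).sup
    (fun m => SchwartzMap.seminorm ℝ m.1 m.2) Θ, by positivity, fun x => ?_⟩
  have h := SchwartzMap.one_add_le_sup_seminorm_apply (𝕜 := ℝ) (m := (2, 0)) (k := 2) (n := 0)
    le_rfl le_rfl Θ x
  rw [norm_iteratedFDeriv_zero, Real.norm_eq_abs] at h
  rwa [quadDecay, ← div_eq_mul_inv, le_div_iff₀' (by positivity)]

lemma exists_norm_schwartz_sub_le (Θ : 𝓢(ℝ, ℂ)) :
    ∃ C : ℝ, 0 ≤ C ∧ ∀ x y, ‖Θ x - Θ y‖ ≤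
      C * min 1 |x - y| * (quadDecay x + quadDecay y) := by
  obtain ⟨C, hC, hΘ⟩ := exists_norm_schwartz_le Θ
  obtain ⟨C', hC', hderiv⟩ := exists_norm_schwartz_le (SchwartzMap.derivCLM ℝ ℂ Θ)
  refine ⟨C + 4 * C', by positivity, fun x y => ?_⟩
  have hx := quadDecay_nonneg x
  have hy := quadDecay_nonneg y
  rcases le_total 1 |x - y| with hfar | hnear
  · calc ‖Θ x - Θ y‖ ≤ C * (quadDecay x + quadDecay y) := by
          linarith [norm_sub_le (Θ x) (Θ y), hΘ x, hΘ y]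
      _ ≤ _ := by
          rw [min_eq_left hfar, mul_one]
          gcongr
          linarith
  · have hball : ∀ z ∈ Metric.closedBall y |x - y|, ‖deriv Θ z‖ ≤ 4 * C' * quadDecay y := by
      intro z hz
      have hzy := quadDecay_le_four_mul (hz.trans hnear)
      exact (hderiv z).trans ((mul_le_mul_of_nonneg_left hzy hC').trans_eq (by ring))
    calc ‖Θ x - Θ y‖ ≤ 4 * C' * quadDecay y * ‖x - y‖ :=
          (convex_closedBall y |x - y|).norm_image_sub_le_of_norm_deriv_le
            (fun z _ => Θ.differentiableAt) hball (Metric.mem_closedBall_self (abs_nonneg _))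
            (Metric.mem_closedBall.2 (Real.dist_eq x y).le)
      _ = 4 * C' * |x - y| * quadDecay y := by rw [Real.norm_eq_abs]; ring
      _ ≤ _ := by
          rw [min_eq_right hnear]
          gcongr <;> linarith

lemma summable_quadDecay_int : Summable fun k : ℤ => quadDecay k := by
  have h : Summable fun n : ℕ => quadDecay n := by
    have := (summable_nat_add_iff 1).2 (Real.summable_one_div_nat_pow (p := 2).2 (by norm_num))
    refine this.congr fun n => ?_
    rw [quadDecay, Nat.abs_cast, one_div, Nat.cast_add_one, add_comm]
  refine Summable.of_nat_of_neg (by simpa using h) (by simpa [quadDecay] using h)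

lemma exists_tsum_quadDecay_le :
    ∃ B : ℝ≥0∞, B ≠ ∞ ∧ ∀ x : ℝ, ∑' k : ℤ, ENNReal.ofReal (quadDecay (x - k)) ≤ B := by
  refine ⟨∑' k : ℤ, ENNReal.ofReal (4 * quadDecay k),
    (summable_quadDecay_int.mul_left 4).tsum_ofReal_ne_top, fun x => ?_⟩
  rw [← (Equiv.subLeft ⌊x⌋).tsum_eq]
  refine ENNReal.tsum_le_tsum fun k => ENNReal.ofReal_le_ofReal (quadDecay_le_four_mul ?_)
  rw [Equiv.subLeft_apply, Int.cast_sub, show x - ((⌊x⌋ : ℝ) - k) - k = Int.fract x by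
    rw [Int.fract]; ring, Int.abs_fract]
  exact (Int.fract_lt_one x).le

lemma tsum_indicator_waveletBand_le (ξ : ℝ) (A : ℝ≥0∞) :
    ∑' j : ℤ, {j | ξ ∈ waveletBand j}.indicator (fun _ => A) j ≤ 5 * A := by
  rcases {j | ξ ∈ waveletBand j}.eq_empty_or_nonempty with hempty | ⟨i, hi⟩
  · simp [hempty]
  have houtside : ∀ j ∉ Finset.Icc (i - 2) (i + 2),
      {j | ξ ∈ waveletBand j}.indicator (fun _ => A) j = 0 := by
    refine fun j hj => Set.indicator_of_notMem (fun hξ => hj ?_) _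
    have h1 := le_add_two_of_mem_waveletBand hi hξ
    have h2 := le_add_two_of_mem_waveletBand hξ hi
    rw [Finset.mem_Icc]
    omega
  calc ∑' j : ℤ, {j | ξ ∈ waveletBand j}.indicator (fun _ => A) j
      = ∑ j ∈ Finset.Icc (i - 2) (i + 2), {j | ξ ∈ waveletBand j}.indicator (fun _ => A) j :=
        tsum_eq_sum houtside
    _ ≤ ∑ _ ∈ Finset.Icc (i - 2) (i + 2), A :=
        Finset.sum_le_sum fun j _ => Set.indicator_le_self _ _ j
    _ = 5 * A := by
        rw [Finset.sum_const, Int.card_Icc, nsmul_eq_mul, show i + 2 + 1 - (i - 2) = 5 by ring]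
        rfl

/-- The common majorant `|ξ|^{-a} min(1, |ξ|)`, up to constants, of the kernel `f_v(x, ·)` and of
its wavelet series, where `a = v + 1/α`. -/
def envelope (a ξ : ℝ) : ℝ := |ξ| ^ (-a) * min 1 |ξ|

lemma envelope_nonneg (a ξ : ℝ) : 0 ≤ envelope a ξ := by unfold envelope; positivity

lemma IsLemarieMeyer.exists_norm_wCoeff_le {ψ : 𝓢(ℝ, ℝ)} (hψ : IsLemarieMeyer ψ) (α v : ℝ) :
    ∃ C : ℝ, 0 ≤ C ∧ ∀ (j k : ℤ) (x : ℝ), ‖wCoeff α ψ v j k x‖ ≤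
      C * ((2 : ℝ) ^ (-((j : ℝ) * v)) * min 1 |(2 : ℝ) ^ j * x|) *
        (quadDecay ((2 : ℝ) ^ j * x - k) + quadDecay (0 - k)) := by
  obtain ⟨Θ, hΘ⟩ := hψ.exists_schwartz_psiFrac α v
  obtain ⟨C, hC, hinc⟩ := exists_norm_schwartz_sub_le Θ
  refine ⟨C, hC, fun j k x => ?_⟩
  have h := hinc ((2 : ℝ) ^ j * x - k) (0 - k)
  rw [sub_sub_sub_cancel_right, sub_zero, hΘ, hΘ] at h
  rw [hψ.wCoeff_eq, norm_mul, Complex.norm_real, Real.norm_of_nonneg (by positivity),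
    ← zero_sub (k : ℝ)]
  refine (mul_le_mul_of_nonneg_left h (by positivity)).trans_eq ?_
  ring

lemma exists_norm_psiHat_le (α : ℝ) (ψ : 𝓢(ℝ, ℝ)) :
    ∃ C : ℝ, 0 ≤ C ∧ ∀ (j k : ℤ) (ξ : ℝ),
      ‖psiHat α ψ j k ξ‖ ≤ C * (2 : ℝ) ^ (-((j : ℝ) * (1 / α))) := by
  obtain ⟨g, hg⟩ := exists_schwartz_fourierHat_ofReal ψ
  obtain ⟨C, hC, hdec⟩ := exists_norm_schwartz_le g
  refine ⟨C, hC, fun j k ξ => ?_⟩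
  rw [norm_psiHat, ← hg, mul_comm C]
  gcongr
  exact (hdec _).trans (mul_le_of_le_one_right hC (quadDecay_le_one _))

lemma two_rpow_mul_min_le_envelope {a ξ : ℝ} {j : ℤ} (ha : 0 ≤ a) (hξ : ξ ∈ waveletBand j)
    (x : ℝ) : (2 : ℝ) ^ (-((j : ℝ) * a)) * min 1 |(2 : ℝ) ^ j * x| ≤
      (8 * Real.pi / 3) ^ a * (1 + |x|) * envelope a ξ := by
  have h2 : (0 : ℝ) < 2 ^ j := by positivity
  have h2ξ : (2 : ℝ) ^ j ≤ |ξ| := by nlinarith [hξ.1, Real.pi_gt_three]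
  have hξ0 : 0 < |ξ| := h2.trans_le h2ξ
  have hpow : (2 : ℝ) ^ (-((j : ℝ) * a)) ≤ (8 * Real.pi / 3) ^ a * |ξ| ^ (-a) := by
    rw [← mul_neg, Real.rpow_mul (by norm_num), Real.rpow_intCast, Real.rpow_neg h2.le,
      Real.rpow_neg hξ0.le, ← div_eq_mul_inv, le_div_iff₀ (by positivity),
      inv_mul_le_iff₀ (by positivity), ← Real.mul_rpow h2.le (by positivity)]
    exact Real.rpow_le_rpow hξ0.le hξ.2 ha
  have hmin : min 1 |(2 : ℝ) ^ j * x| ≤ (1 + |x|) * min 1 |ξ| := by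
    have hx := abs_nonneg x
    rw [abs_mul, abs_of_pos h2, mul_min_of_nonneg _ _ (by positivity), mul_one]
    exact min_le_min (by linarith) (by nlinarith)
  calc _ ≤ (8 * Real.pi / 3) ^ a * |ξ| ^ (-a) * ((1 + |x|) * min 1 |ξ|) := by gcongr
    _ = _ := by rw [envelope]; ring

lemma IsLemarieMeyer.exists_norm_wCoeff_mul_psiHat_le {ψ : 𝓢(ℝ, ℝ)} (hψ : IsLemarieMeyer ψ)
    {α v : ℝ} (hv : 0 ≤ v + 1 / α) (x : ℝ) :
    ∃ C : ℝ, 0 ≤ C ∧ ∀ (j k : ℤ) (ξ : ℝ),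
      ‖wCoeff α ψ v j k x * conj (psiHat α ψ j k ξ)‖ ≤
        {j | ξ ∈ waveletBand j}.indicator (fun _ => C * envelope (v + 1 / α) ξ) j *
          (quadDecay ((2 : ℝ) ^ j * x - k) + quadDecay (0 - k)) := by
  obtain ⟨C₁, hC₁, hw⟩ := hψ.exists_norm_wCoeff_le α v
  obtain ⟨C₂, hC₂, hpsi⟩ := exists_norm_psiHat_le α ψ
  refine ⟨C₁ * C₂ * ((8 * Real.pi / 3) ^ (v + 1 / α) * (1 + |x|)), by positivity,
    fun j k ξ => ?_⟩
  by_cases hj : ξ ∈ waveletBand j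
  swap
  · have : psiHat α ψ j k ξ = 0 := not_not.1 (mt hψ.mem_waveletBand hj)
    simp [this, hj]
  have hq1 := quadDecay_nonneg ((2 : ℝ) ^ j * x - k)
  have hq2 := quadDecay_nonneg (0 - k)
  have hpow : (2 : ℝ) ^ (-((j : ℝ) * v)) * (2 : ℝ) ^ (-((j : ℝ) * (1 / α))) =
      (2 : ℝ) ^ (-((j : ℝ) * (v + 1 / α))) := by
    rw [← Real.rpow_add (by norm_num)]
    congr 1
    ring
  rw [Set.indicator_of_mem (s := {j | ξ ∈ waveletBand j}) hj, norm_mul, Complex.norm_conj]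
  calc _ ≤ C₁ * ((2 : ℝ) ^ (-((j : ℝ) * v)) * min 1 |(2 : ℝ) ^ j * x|) *
        (quadDecay ((2 : ℝ) ^ j * x - k) + quadDecay (0 - k)) *
          (C₂ * (2 : ℝ) ^ (-((j : ℝ) * (1 / α)))) :=
        mul_le_mul (hw j k x) (hpsi j k ξ) (norm_nonneg _) (by positivity)
    _ = C₁ * C₂ * ((2 : ℝ) ^ (-((j : ℝ) * (v + 1 / α))) * min 1 |(2 : ℝ) ^ j * x|) *
        (quadDecay ((2 : ℝ) ^ j * x - k) + quadDecay (0 - k)) := by rw [← hpow]; ring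
    _ ≤ C₁ * C₂ * ((8 * Real.pi / 3) ^ (v + 1 / α) * (1 + |x|) * envelope (v + 1 / α) ξ) *
        (quadDecay ((2 : ℝ) ^ j * x - k) + quadDecay (0 - k)) := by
        gcongr ?_ * _
        exact mul_le_mul_of_nonneg_left (two_rpow_mul_min_le_envelope hv hj x) (by positivity)
    _ = _ := by ring

lemma IsLemarieMeyer.exists_tsum_wCoeff_mul_psiHat_le {ψ : 𝓢(ℝ, ℝ)} (hψ : IsLemarieMeyer ψ)
    {α v : ℝ} (hv : 0 ≤ v + 1 / α) (x : ℝ) :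
    ∃ C : ℝ, 0 ≤ C ∧ ∀ ξ, ∑' p : ℤ × ℤ,
      ‖wCoeff α ψ v p.1 p.2 x * conj (psiHat α ψ p.1 p.2 ξ)‖ₑ ≤
        ENNReal.ofReal (C * envelope (v + 1 / α) ξ) := by
  obtain ⟨C, hC, hterm⟩ := hψ.exists_norm_wCoeff_mul_psiHat_le hv x
  obtain ⟨B, hB, hsum⟩ := exists_tsum_quadDecay_le
  refine ⟨C * (5 * (B + B)).toReal, by positivity, fun ξ => ?_⟩
  set E := ENNReal.ofReal (C * envelope (v + 1 / α) ξ) with hE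
  have henorm (j k : ℤ) : ‖wCoeff α ψ v j k x * conj (psiHat α ψ j k ξ)‖ₑ ≤
      {j | ξ ∈ waveletBand j}.indicator (fun _ => E) j *
        (ENNReal.ofReal (quadDecay ((2 : ℝ) ^ j * x - k)) +
          ENNReal.ofReal (quadDecay (0 - k))) := by
    have h := ENNReal.ofReal_le_ofReal (hterm j k ξ)
    rw [ofReal_norm] at h
    refine h.trans_eq ?_
    rw [ENNReal.ofReal_mul' (add_nonneg (quadDecay_nonneg _) (quadDecay_nonneg _)),
      ENNReal.ofReal_add (quadDecay_nonneg _) (quadDecay_nonneg _)]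
    by_cases hj : ξ ∈ waveletBand j <;> simp [hj, hE]
  calc ∑' p : ℤ × ℤ, ‖wCoeff α ψ v p.1 p.2 x * conj (psiHat α ψ p.1 p.2 ξ)‖ₑ
      = ∑' (j : ℤ) (k : ℤ), ‖wCoeff α ψ v j k x * conj (psiHat α ψ j k ξ)‖ₑ :=
        ENNReal.tsum_prod (f := fun j k => ‖wCoeff α ψ v j k x * conj (psiHat α ψ j k ξ)‖ₑ)
    _ ≤ ∑' j : ℤ, {j | ξ ∈ waveletBand j}.indicator (fun _ => E) j * (B + B) := by
        refine ENNReal.tsum_le_tsum fun j => (ENNReal.tsum_le_tsum (henorm j)).trans ?_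
        rw [ENNReal.tsum_mul_left, ENNReal.tsum_add]
        gcongr <;> exact hsum _
    _ ≤ 5 * E * (B + B) := by
        rw [ENNReal.tsum_mul_right]
        gcongr
        exact tsum_indicator_waveletBand_le ξ _
    _ = ENNReal.ofReal (C * (5 * (B + B)).toReal * envelope (v + 1 / α) ξ) := by
        have hB5 : 5 * (B + B) ≠ ∞ := ENNReal.mul_ne_top (by simp) (by simp [hB])
        rw [mul_right_comm C, ENNReal.ofReal_mul (mul_nonneg hC (envelope_nonneg _ _)),
          ENNReal.ofReal_toReal hB5, ← hE]
        ring

lemma norm_exp_sub_one_le_min (x ξ : ℝ) :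
    ‖Complex.exp (Complex.I * (x : ℂ) * (ξ : ℂ)) - 1‖ ≤ (2 + |x|) * min 1 |ξ| := by
  rw [mul_assoc, ← Complex.ofReal_mul]
  have hx := abs_nonneg x
  rcases le_total 1 |ξ| with h | h
  · rw [min_eq_left h]
    refine (norm_sub_le _ _).trans ?_
    rw [Complex.norm_exp_I_mul_ofReal, norm_one]
    linarith
  · rw [min_eq_right h]
    refine Real.norm_exp_I_mul_ofReal_sub_one_le.trans ?_
    rw [Real.norm_eq_abs, abs_mul]
    nlinarith [abs_nonneg ξ]

lemma norm_fKer_le (α v x ξ : ℝ) :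
    ‖fKer α v x ξ‖ ≤ (2 + |x|) * envelope (v + 1 / α) ξ := by
  rw [fKer, norm_div, Complex.norm_real, Real.norm_of_nonneg (by positivity), envelope,
    Real.rpow_neg (abs_nonneg ξ), div_eq_mul_inv]
  calc _ ≤ ((2 + |x|) * min 1 |ξ|) * (|ξ| ^ (v + 1 / α))⁻¹ := by
        gcongr
        exact norm_exp_sub_one_le_min x ξ
    _ = _ := by ring

lemma measurable_fKer (α v x : ℝ) : Measurable (fKer α v x) := by unfold fKer; fun_prop

lemma measurable_envelope (a : ℝ) : Measurable (envelope a) := by unfold envelope; fun_prop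

lemma integrable_envelope_rpow {a α : ℝ} (ha : 1 < a * α) (ha' : (a - 1) * α < 1) :
    Integrable fun ξ => envelope a ξ ^ α := by
  have hpolar := integrable_fun_norm_addHaar (volume : Measure ℝ)
    (f := fun u => (u ^ (-a) * min 1 u) ^ α)
  simp only [Module.finrank_self, tsub_self, pow_zero, one_smul, Real.norm_eq_abs] at hpolar
  refine hpolar.2 ?_
  rw [← Set.Ioc_union_Ioi_eq_Ioi (zero_le_one (α := ℝ))]
  refine IntegrableOn.union ?_ ?_
  · have h := intervalIntegral.intervalIntegrable_rpow' (a := 0) (b := 1)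
      (r := (1 - a) * α) (by linarith)
    rw [intervalIntegrable_iff_integrableOn_Ioc_of_le zero_le_one] at h
    refine h.congr_fun (fun u hu => ?_) measurableSet_Ioc
    simp only
    rw [min_eq_right hu.2, Real.rpow_mul hu.1.le, ← Real.rpow_add_one hu.1.ne', neg_add_eq_sub]
  · have h := integrableOn_Ioi_rpow_of_lt (a := -a * α) (c := 1) (by linarith) one_pos
    refine h.congr_fun (fun u (hu : 1 < u) => ?_) measurableSet_Ioi
    simp only
    rw [min_eq_left hu.le, mul_one, Real.rpow_mul (by linarith)]

end Domination

section Expansion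

lemma ae_hasSum_of_summable_of_hilbertBasis {ι E : Type*} [Countable ι] [MeasurableSpace E]
    {μ : Measure E} (b : HilbertBasis ι ℂ (Lp ℂ 2 μ)) {e : ι → E → ℂ}
    (he : ∀ i, (b i : E → ℂ) =ᵐ[μ] e i) {g : E → ℂ} (hg : MemLp g 2 μ) :
    ∀ᵐ x ∂μ, (Summable fun i => (∫ y, conj (e i y) * g y ∂μ) * e i x) →
      HasSum (fun i => (∫ y, conj (e i y) * g y ∂μ) * e i x) (g x) := by
  have hcoeff (i : ι) : b.repr (hg.toLp) i = ∫ y, conj (e i y) * g y ∂μ := by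
    rw [b.repr_apply_apply, L2.inner_def]
    refine integral_congr_ae ?_
    filter_upwards [he i, hg.coeFn_toLp] with y hey hgy
    rw [hey, hgy, RCLike.inner_apply']
  obtain ⟨s, hs, hlim⟩ := (tendstoInMeasure_of_tendsto_Lp (p := 2)
    (b.hasSum_repr hg.toLp)).exists_seq_tendsto_ae'
  have hterm : ∀ᵐ x ∂μ, ∀ n, (∑ i ∈ s n, b.repr hg.toLp i • b i : Lp ℂ 2 μ) x =
      ∑ i ∈ s n, (b.repr hg.toLp i • b i : Lp ℂ 2 μ) x :=
    ae_all_iff.2 fun n => by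
      filter_upwards [Lp.coeFn_finsetSum (s n) fun i => b.repr hg.toLp i • b i] with x hx
      rw [hx, Finset.sum_apply]
  have hsmul : ∀ᵐ x ∂μ, ∀ i, (b.repr hg.toLp i • b i : Lp ℂ 2 μ) x =
      (∫ y, conj (e i y) * g y ∂μ) * e i x :=
    ae_all_iff.2 fun i => by
      filter_upwards [Lp.coeFn_smul (b.repr hg.toLp i) (b i), he i] with x hx hex
      rw [hx, Pi.smul_apply, hex, hcoeff, smul_eq_mul]
  filter_upwards [hlim, hterm, hsmul, hg.coeFn_toLp] with x hlim hterm hsmul hgx hsummable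
  have hlim' : Tendsto (fun n => ∑ i ∈ s n, (∫ y, conj (e i y) * g y ∂μ) * e i x) atTop
      (𝓝 (g x)) := by
    simpa only [hterm, hsmul, hgx] using hlim
  rw [tendsto_nhds_unique hlim' (hsummable.hasSum.comp hs)]
  exact hsummable.hasSum

lemma fourierInv_eq_conj_fourierHat {φ : ℝ → ℂ} (hφ : ∀ x, conj (φ x) = φ x) (u : ℝ) :
    FourierTransformInv.fourierInv φ u =
      (Real.sqrt (2 * Real.pi) : ℂ) * conj (fourierHat φ (2 * Real.pi * u)) := by
  have hsqrt : (Real.sqrt (2 * Real.pi) : ℂ) * (((2 * Real.pi) ^ (-(1 / 2 : ℝ)) : ℝ) : ℂ) = 1 := by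
    rw [← Complex.ofReal_mul, Real.sqrt_eq_rpow, ← Real.rpow_add (by positivity), add_neg_cancel,
      Real.rpow_zero, Complex.ofReal_one]
  rw [fourierHat, map_mul, Complex.conj_ofReal, ← mul_assoc, hsqrt, one_mul, ← integral_conj,
    Real.fourierInv_eq']
  refine integral_congr_ae (Eventually.of_forall fun s => ?_)
  simp only [RCLike.inner_apply, conj_trivial, smul_eq_mul, map_mul, hφ, ← Complex.exp_conj,
    map_neg, Complex.conj_I, Complex.conj_ofReal]
  congr 2
  push_cast
  ring

lemma IsLemarieMeyer.exists_hilbertBasis_conj_fourierHat {ψ : 𝓢(ℝ, ℝ)} (hψ : IsLemarieMeyer ψ) :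
    ∃ b : HilbertBasis (ℤ × ℤ) ℂ (Lp ℂ 2 (volume : Measure ℝ)), ∀ p, (b p : ℝ → ℂ) =ᵐ[volume]
      fun u => (Real.sqrt (2 * Real.pi) : ℂ) *
        conj (fourierHat (psiJK ψ p.1 p.2) (2 * Real.pi * u)) := by
  obtain ⟨b, hb⟩ := hψ.orthonormal_basis
  choose φ hφ using exists_schwartz_psiJK ψ
  set U := (Lp.fourierTransformₗᵢ ℝ ℂ).symm
  refine ⟨HilbertBasis.ofRepr (U.symm.trans b.repr), fun p => ?_⟩
  have hbφ : b p = (φ p.1 p.2).toLp 2 := by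
    refine Lp.ext ((hb p.1 p.2).trans ?_)
    filter_upwards [(φ p.1 p.2).coeFn_toLp 2 volume] with x hx
    rw [hx, hφ]
  have hUb : U (b p) = (FourierTransformInv.fourierInv (φ p.1 p.2)).toLp 2 := by
    rw [hbφ]
    exact SchwartzMap.toLp_fourierInv_eq (φ p.1 p.2)
  have hcoe : (HilbertBasis.ofRepr (U.symm.trans b.repr)) p = U (b p) := rfl
  have hreal (x : ℝ) : conj (psiJK ψ p.1 p.2 x) = psiJK ψ p.1 p.2 x := Complex.conj_ofReal _
  rw [hcoe, hUb]
  filter_upwards [(FourierTransformInv.fourierInv (φ p.1 p.2)).coeFn_toLp 2 volume] with u hu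
  rw [hu, SchwartzMap.fourierInv_coe, funext (hφ p.1 p.2), fourierInv_eq_conj_fourierHat hreal]

lemma quasiMeasurePreserving_mul_left {a : ℝ} (ha : a ≠ 0) :
    Measure.QuasiMeasurePreserving (fun x : ℝ => a * x) volume volume := by
  refine ⟨by fun_prop, ?_⟩
  rw [Real.map_volume_mul_left ha]
  exact Measure.smul_absolutelyContinuous

lemma memLp_comp_mul_left {F : ℝ → ℂ} {p : ℝ≥0∞} (hF : MemLp F p volume) {a : ℝ} (ha : a ≠ 0) :
    MemLp (fun x => F (a * x)) p volume := by
  refine MemLp.comp_of_map (f := fun x => a * x) ?_ (by fun_prop)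
  rw [Real.map_volume_mul_left ha]
  exact hF.smul_measure (by simp)

lemma IsLemarieMeyer.ae_hasSum_of_summable {ψ : 𝓢(ℝ, ℝ)} (hψ : IsLemarieMeyer ψ) {F : ℝ → ℂ}
    (hF : MemLp F 2 volume) :
    ∀ᵐ ξ, (Summable fun p : ℤ × ℤ => (∫ η, F η * fourierHat (psiJK ψ p.1 p.2) η) *
        conj (fourierHat (psiJK ψ p.1 p.2) ξ)) →
      HasSum (fun p : ℤ × ℤ => (∫ η, F η * fourierHat (psiJK ψ p.1 p.2) η) *
        conj (fourierHat (psiJK ψ p.1 p.2) ξ)) (F ξ) := by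
  obtain ⟨b, hb⟩ := hψ.exists_hilbertBasis_conj_fourierHat
  have hpi : (0 : ℝ) < 2 * Real.pi := by positivity
  have hsqrt : (Real.sqrt (2 * Real.pi) : ℂ) * (Real.sqrt (2 * Real.pi) : ℂ) =
      ((2 * Real.pi : ℝ) : ℂ) := by
    rw [← Complex.ofReal_mul, Real.mul_self_sqrt hpi.le]
  have hterm (p : ℤ × ℤ) (u : ℝ) :
      (∫ v : ℝ, conj ((Real.sqrt (2 * Real.pi) : ℂ) *
          conj (fourierHat (psiJK ψ p.1 p.2) (2 * Real.pi * v))) * F (2 * Real.pi * v)) *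
        ((Real.sqrt (2 * Real.pi) : ℂ) * conj (fourierHat (psiJK ψ p.1 p.2) (2 * Real.pi * u))) =
      (∫ η, F η * fourierHat (psiJK ψ p.1 p.2) η) *
        conj (fourierHat (psiJK ψ p.1 p.2) (2 * Real.pi * u)) := by
    rw [integral_eq_mul_integral_comp_mul (fun η => F η * fourierHat (psiJK ψ p.1 p.2) η) hpi,
      ← hsqrt]
    simp only [map_mul, Complex.conj_ofReal, Complex.conj_conj, mul_assoc, integral_const_mul]
    simp only [mul_comm (F _)]
    ring
  have h := ae_hasSum_of_summable_of_hilbertBasis b hb (memLp_comp_mul_left hF hpi.ne')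
  simp only [hterm] at h
  filter_upwards [(quasiMeasurePreserving_mul_left (inv_ne_zero hpi.ne')).ae h] with ξ hξ
  simpa only [mul_inv_cancel_left₀ hpi.ne'] using hξ

lemma isCompact_setOf_abs_mem_Icc (a b : ℝ) : IsCompact {ξ : ℝ | |ξ| ∈ Set.Icc a b} :=
  (isCompact_Icc (a := -b) (b := b)).of_isClosed_subset (isClosed_Icc.preimage continuous_abs)
    fun _ hξ => abs_le.1 hξ.2

lemma abs_mem_Icc_of_mem_waveletBand {j : ℤ} {ξ η : ℝ} (hξ : ξ ∈ waveletBand j)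
    (hη : η ∈ waveletBand j) : |η| ∈ Set.Icc (|ξ| / 4) (4 * |ξ|) := by
  constructor <;> linarith [hξ.1, hξ.2, hη.1, hη.2]

lemma psiHat_eq_zero_iff (α : ℝ) (ψ : ℝ → ℝ) (j k : ℤ) (ξ : ℝ) :
    psiHat α ψ j k ξ = 0 ↔ fourierHat (psiJK ψ j k) ξ = 0 := by
  rw [psiHat, mul_eq_zero, or_iff_right]
  exact_mod_cast (by positivity : (0 : ℝ) < 2 ^ (-((j : ℝ) * (1 / α - 1 / 2)))).ne'

lemma IsLemarieMeyer.ae_hasSum_of_summable_of_memLp_compact {ψ : 𝓢(ℝ, ℝ)} (hψ : IsLemarieMeyer ψ)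
    {F : ℝ → ℂ} (hF : ∀ K, IsCompact K → (0 : ℝ) ∉ K → MemLp F 2 (volume.restrict K)) :
    ∀ᵐ ξ : ℝ, Summable (fun p : ℤ × ℤ => (∫ η, F η * fourierHat (psiJK ψ p.1 p.2) η) *
        conj (fourierHat (psiJK ψ p.1 p.2) ξ)) →
      HasSum (fun p : ℤ × ℤ => (∫ η, F η * fourierHat (psiJK ψ p.1 p.2) η) *
        conj (fourierHat (psiJK ψ p.1 p.2) ξ)) (F ξ) := by
  let K (n : ℕ) : Set ℝ := {ξ | |ξ| ∈ Set.Icc ((n : ℝ) + 1)⁻¹ (n + 1)}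
  have hK (n : ℕ) : IsCompact (K n) := isCompact_setOf_abs_mem_Icc _ _
  have h0K (n : ℕ) : (0 : ℝ) ∉ K n := fun h => by
    have : ((n : ℝ) + 1)⁻¹ ≤ 0 := by simpa using h.1
    exact this.not_gt (by positivity)
  have hFK (n : ℕ) : MemLp ((K n).indicator F) 2 volume :=
    (memLp_indicator_iff_restrict (hK n).measurableSet).2 (hF _ (hK n) (h0K n))
  filter_upwards [ae_all_iff.2 fun n => hψ.ae_hasSum_of_summable (hFK n),
    Measure.ae_ne volume (0 : ℝ)] with ξ hξ hξ0
  have hξ0 : 0 < |ξ| := abs_pos.2 hξ0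
  obtain ⟨n, hn⟩ := exists_nat_ge (max (4 * |ξ|) (|ξ| / 4)⁻¹)
  have hn₁ : ((n : ℝ) + 1)⁻¹ ≤ |ξ| / 4 :=
    inv_le_of_inv_le₀ (by positivity) (((le_max_right _ _).trans hn).trans (by linarith))
  have hn₂ : 4 * |ξ| ≤ n + 1 := ((le_max_left _ _).trans hn).trans (by linarith)
  have hcoeff (p : ℤ × ℤ) :
      (∫ η, (K n).indicator F η * fourierHat (psiJK ψ p.1 p.2) η) *
          conj (fourierHat (psiJK ψ p.1 p.2) ξ) =
        (∫ η, F η * fourierHat (psiJK ψ p.1 p.2) η) * conj (fourierHat (psiJK ψ p.1 p.2) ξ) := by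
    by_cases hpξ : fourierHat (psiJK ψ p.1 p.2) ξ = 0
    · simp only [hpξ, map_zero, mul_zero]
    congr 2 with η
    by_cases hpη : fourierHat (psiJK ψ p.1 p.2) η = 0
    · simp only [hpη, mul_zero]
    rw [← psiHat_eq_zero_iff 1] at hpξ hpη
    obtain ⟨hη₁, hη₂⟩ :=
      abs_mem_Icc_of_mem_waveletBand (hψ.mem_waveletBand hpξ) (hψ.mem_waveletBand hpη)
    rw [Set.indicator_of_mem (s := K n) ⟨hn₁.trans hη₁, hη₂.trans hn₂⟩]
  have hξK : ξ ∈ K n := ⟨hn₁.trans (by linarith), by linarith⟩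
  simpa only [hcoeff, Set.indicator_of_mem hξK] using hξ n

lemma memLp_fKer_restrict (α v x : ℝ) (p : ℝ≥0∞) {K : Set ℝ} (hK : IsCompact K)
    (h0 : (0 : ℝ) ∉ K) : MemLp (fKer α v x) p (volume.restrict K) := by
  have hcont : ContinuousOn (fKer α v x) K := by
    refine ContinuousOn.div (by fun_prop) ?_ fun ξ hξ => ?_
    · exact Complex.continuous_ofReal.comp_continuousOn <| continuous_abs.continuousOn.rpow_const
        fun ξ hξ => Or.inl (abs_ne_zero.2 (ne_of_mem_of_not_mem hξ h0))
    · have : 0 < |ξ| := abs_pos.2 (ne_of_mem_of_not_mem hξ h0)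
      exact_mod_cast (Real.rpow_pos_of_pos this _).ne'
  obtain ⟨C, hC⟩ := hK.exists_bound_of_continuousOn hcont
  have : IsFiniteMeasure (volume.restrict K) := isFiniteMeasure_restrict.2 hK.measure_ne_top
  exact .of_bound (hcont.aestronglyMeasurable hK.measurableSet) C
    (ae_restrict_of_forall_mem hK.measurableSet hC)

lemma wCoeff_mul_conj_psiHat (α : ℝ) (ψ : ℝ → ℝ) (v : ℝ) (j k : ℤ) (x ξ : ℝ) :
    wCoeff α ψ v j k x * conj (psiHat α ψ j k ξ) =
      (∫ η, fKer α v x η * fourierHat (psiJK ψ j k) η) * conj (fourierHat (psiJK ψ j k) ξ) := by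
  have hscale : (((2 : ℝ) ^ ((j : ℝ) * (1 / α - 1 / 2)) : ℝ) : ℂ) *
      (((2 : ℝ) ^ (-((j : ℝ) * (1 / α - 1 / 2))) : ℝ) : ℂ) = 1 := by
    rw [← Complex.ofReal_mul, ← Real.rpow_add two_pos, add_neg_cancel, Real.rpow_zero,
      Complex.ofReal_one]
  rw [wCoeff, psiHat, map_mul, Complex.conj_ofReal, mul_mul_mul_comm, hscale, one_mul]

lemma IsLemarieMeyer.ae_hasSum_wCoeff_mul_psiHat {ψ : 𝓢(ℝ, ℝ)} (hψ : IsLemarieMeyer ψ) {α v : ℝ}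
    (hv : 0 ≤ v + 1 / α) (x : ℝ) :
    ∀ᵐ ξ : ℝ, HasSum (fun p : ℤ × ℤ => wCoeff α ψ v p.1 p.2 x * conj (psiHat α ψ p.1 p.2 ξ))
      (fKer α v x ξ) := by
  obtain ⟨C, -, hC⟩ := hψ.exists_tsum_wCoeff_mul_psiHat_le hv x
  have hsum (ξ : ℝ) : Summable fun p : ℤ × ℤ =>
      wCoeff α ψ v p.1 p.2 x * conj (psiHat α ψ p.1 p.2 ξ) :=
    .of_enorm ((hC ξ).trans_lt ENNReal.ofReal_lt_top).ne
  simp only [wCoeff_mul_conj_psiHat] at hsum ⊢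
  filter_upwards [hψ.ae_hasSum_of_summable_of_memLp_compact
    fun K hK h0 => memLp_fKer_restrict α v x 2 hK h0] with ξ hξ
  exact hξ (hsum ξ)

end Expansion

section Tensor

lemma enorm_finsetProd {ι 𝕜 : Type*} [NormedField 𝕜] (s : Finset ι) (f : ι → 𝕜) :
    ‖∏ i ∈ s, f i‖ₑ = ∏ i ∈ s, ‖f i‖ₑ := by
  simp only [enorm, nnnorm_prod, ENNReal.ofNNReal_finsetProd]

variable {ι : Type*} [Fintype ι]

lemma tsum_pi_prod_le_prod_tsum {β : Type*} (a : ι → β → ℝ≥0∞) :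
    ∑' f : ι → β, ∏ l, a l (f l) ≤ ∏ l, ∑' b, a l b := by
  classical
  rw [ENNReal.tsum_eq_iSup_sum]
  refine iSup_le fun D => ?_
  have hbox : D ⊆ Fintype.piFinset fun l => D.image fun f => f l := fun f hf =>
    Fintype.mem_piFinset.2 fun l => Finset.mem_image_of_mem (fun f => f l) hf
  calc ∑ f ∈ D, ∏ l, a l (f l)
      ≤ ∑ f ∈ Fintype.piFinset fun l => D.image fun f => f l, ∏ l, a l (f l) :=
        Finset.sum_le_sum_of_subset hbox
    _ = ∏ l, ∑ b ∈ D.image fun f => f l, a l b := (Finset.prod_univ_sum _ _).symm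
    _ ≤ ∏ l, ∑' b, a l b := Finset.prod_le_prod' fun l _ => ENNReal.sum_le_tsum _

lemma tendsto_piFinset_const_atTop (β : Type*) [DecidableEq ι] :
    Tendsto (fun B : Finset β => Fintype.piFinset fun _ : ι => B) atTop atTop := by
  classical
  refine tendsto_atTop.2 fun D => ?_
  filter_upwards [eventually_ge_atTop (D.biUnion fun f => Finset.univ.image f)] with B hB f hf
  exact Fintype.mem_piFinset.2 fun l => hB (Finset.mem_biUnion.2
    ⟨f, hf, Finset.mem_image_of_mem f (Finset.mem_univ l)⟩)

lemma hasSum_pi_prod {𝕜 β : Type*} [NormedField 𝕜] [CompleteSpace 𝕜] {a : ι → β → 𝕜} {s : ι → 𝕜}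
    (h : ∀ l, HasSum (a l) (s l)) (hfin : ∀ l, ∑' b, ‖a l b‖ₑ ≠ ∞) :
    HasSum (fun f : ι → β => ∏ l, a l (f l)) (∏ l, s l) := by
  classical
  have hsummable : Summable fun f : ι → β => ∏ l, a l (f l) := by
    refine Summable.of_enorm (ne_top_of_le_ne_top (ENNReal.prod_ne_top
      (s := Finset.univ) fun l _ => hfin l) ?_)
    simp only [enorm_finsetProd]
    exact tsum_pi_prod_le_prod_tsum fun l b => ‖a l b‖ₑ
  have hbox := hsummable.hasSum.comp (tendsto_piFinset_const_atTop β)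
  have hprod : Tendsto (fun B : Finset β => ∏ l, ∑ b ∈ B, a l b) atTop (𝓝 (∏ l, s l)) :=
    tendsto_finsetProd _ fun l _ => h l
  simp only [Finset.prod_univ_sum] at hprod
  rw [tendsto_nhds_unique hprod hbox]
  exact hsummable.hasSum

lemma memLp_finsetProd_eval {E : ι → Type*} [∀ l, MeasurableSpace (E l)]
    {μ : ∀ l, Measure (E l)} [∀ l, SigmaFinite (μ l)] {𝕜 : Type*} [NormedField 𝕜]
    {f : ∀ l, E l → 𝕜} {p : ℝ≥0∞} (hp₀ : p ≠ 0) (hp : p ≠ ∞) (hf : ∀ l, MemLp (f l) p (μ l)) :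
    MemLp (fun x : ∀ l, E l => ∏ l, f l (x l)) p (Measure.pi μ) := by
  have hmeas : AEStronglyMeasurable (fun x : ∀ l, E l => ∏ l, f l (x l)) (Measure.pi μ) :=
    Finset.aestronglyMeasurable_fun_prod _ fun l _ =>
      (hf l).1.comp_quasiMeasurePreserving (Measure.quasiMeasurePreserving_eval μ l)
  rw [← integrable_norm_rpow_iff hmeas hp₀ hp]
  simp only [norm_prod, ← Real.finsetProd_rpow _ _ fun l _ => norm_nonneg (f l _)]
  exact Integrable.fintype_prod_dep fun l => (hf l).integrable_norm_rpow hp₀ hp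

end Tensor

lemma tendsto_eLpNorm_sub_of_dominated {X E ι : Type*} [MeasurableSpace X] {μ : Measure X}
    [NormedAddCommGroup E] {l : Filter ι} [l.IsCountablyGenerated] {F : ι → X → E} {f : X → E}
    {G : X → ℝ} {p : ℝ≥0∞} (hp₀ : p ≠ 0) (hp : p ≠ ∞) (hF : ∀ i, AEStronglyMeasurable (F i) μ)
    (hf : AEStronglyMeasurable f μ) (hG : MemLp G p μ) (hFG : ∀ᵐ x ∂μ, ∀ i, ‖F i x‖ ≤ G x)
    (hlim : ∀ᵐ x ∂μ, Tendsto (fun i => F i x) l (𝓝 (f x))) :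
    Tendsto (fun i => eLpNorm (F i - f) p μ) l (𝓝 0) := by
  rcases l.eq_or_neBot with rfl | hl
  · exact tendsto_bot
  have hp' : 0 < p.toReal := ENNReal.toReal_pos hp₀ hp
  have hlint : Tendsto (fun i => ∫⁻ x, ‖F i x - f x‖ₑ ^ p.toReal ∂μ) l (𝓝 (∫⁻ _, 0 ∂μ)) := by
    refine tendsto_lintegral_filter_of_dominated_convergence' (fun x => ‖2 * G x‖ₑ ^ p.toReal)
      (.of_forall fun i => ((hF i).sub hf).enorm.pow_const _) (.of_forall fun i => ?_) ?_ ?_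
    · filter_upwards [hFG, hlim] with x hx hx'
      have hfG : ‖f x‖ ≤ G x := le_of_tendsto' hx'.norm hx
      refine ENNReal.rpow_le_rpow (enorm_le_iff_norm_le.2 ?_) hp'.le
      calc ‖F i x - f x‖ ≤ ‖F i x‖ + ‖f x‖ := norm_sub_le _ _
        _ ≤ 2 * G x := by linarith [hx i]
        _ ≤ ‖2 * G x‖ := le_abs_self _
    · exact (lintegral_rpow_enorm_lt_top_of_eLpNorm_lt_top hp₀ hp (hG.const_mul 2).2).ne
    · filter_upwards [hlim] with x hx
      simpa [hp'] using (hx.sub_const (f x)).enorm.ennrpow_const p.toReal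
  rw [lintegral_zero] at hlint
  simpa [eLpNorm_eq_lintegral_rpow_enorm_toReal hp₀ hp, hp']
    using hlint.ennrpow_const (1 / p.toReal)

section Kernel

variable {N : ℕ} {α : ℝ}

lemma memLp_envelope {v : ℝ} (hα : 0 < α) (hv : 0 < v) (hv' : v < 1) :
    MemLp (envelope (v + 1 / α)) (ENNReal.ofReal α) volume := by
  have hvα : (v + 1 / α) * α = v * α + 1 := by field_simp
  rw [← integrable_norm_rpow_iff (measurable_envelope _).aestronglyMeasurable (by simpa) (by simp),
    ENNReal.toReal_ofReal hα.le]
  simp only [Real.norm_of_nonneg (envelope_nonneg _ _)]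
  exact integrable_envelope_rpow (by nlinarith) (by nlinarith)

lemma memLp_fKer {v : ℝ} (hα : 0 < α) (hv : 0 < v) (hv' : v < 1) (x : ℝ) :
    MemLp (fKer α v x) (ENNReal.ofReal α) volume :=
  ((memLp_envelope hα hv hv').const_mul (2 + |x|)).mono'
    (measurable_fKer α v x).aestronglyMeasurable (.of_forall (norm_fKer_le α v x))

lemma memLp_kernel (hα : 0 < α) {H : Fin N → ℝ} (hH : ∀ l, 0 < H l ∧ H l < 1) (t : Fin N → ℝ) :
    MemLp (kernel α H t) (ENNReal.ofReal α) volume :=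
  memLp_finsetProd_eval (by simpa) (by simp) fun l => memLp_fKer hα (hH l).1 (hH l).2 (t l)

lemma memLp_conj_bigPsiHat (hα : 0 < α) (ψ : 𝓢(ℝ, ℝ)) (J K : Fin N → ℤ) :
    MemLp (fun x => conj (bigPsiHat α ψ J K x)) (ENNReal.ofReal α) volume := by
  refine MemLp.star (memLp_finsetProd_eval (by simpa) (by simp) fun l => ?_)
  obtain ⟨g, hg⟩ := exists_schwartz_psiHat α ψ (J l) (K l)
  exact funext hg ▸ g.memLp _

lemma prod_wCoeff_mul_conj_bigPsiHat (ψ : ℝ → ℝ) (H t x : Fin N → ℝ) (J K : Fin N → ℤ) :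
    (∏ l, wCoeff α ψ (H l) (J l) (K l) (t l)) * conj (bigPsiHat α ψ J K x) =
      ∏ l, wCoeff α ψ (H l) (J l) (K l) (t l) * conj (psiHat α ψ (J l) (K l) (x l)) := by
  rw [bigPsiHat, map_prod, Finset.prod_mul_distrib]

lemma IsLemarieMeyer.exists_memLp_norm_sum_le {ψ : 𝓢(ℝ, ℝ)} (hψ : IsLemarieMeyer ψ) (hα : 0 < α)
    {H : Fin N → ℝ} (hH : ∀ l, 0 < H l ∧ H l < 1) (t : Fin N → ℝ) :
    ∃ G : (Fin N → ℝ) → ℝ, MemLp G (ENNReal.ofReal α) volume ∧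
      ∀ x (D : Finset ((Fin N → ℤ) × (Fin N → ℤ))),
        ‖∑ p ∈ D, (∏ l, wCoeff α ψ (H l) (p.1 l) (p.2 l) (t l)) *
          conj (bigPsiHat α ψ p.1 p.2 x)‖ ≤ G x := by
  choose C hC₀ hC using fun l =>
    hψ.exists_tsum_wCoeff_mul_psiHat_le (α := α) (v := H l)
      (add_nonneg (hH l).1.le (by positivity)) (t l)
  refine ⟨fun x => ∏ l, C l * envelope (H l + 1 / α) (x l),
    memLp_finsetProd_eval (by simpa) (by simp)
      fun l => (memLp_envelope hα (hH l).1 (hH l).2).const_mul (C l), fun x D => ?_⟩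
  have hnonneg (l) : 0 ≤ C l * envelope (H l + 1 / α) (x l) :=
    mul_nonneg (hC₀ l) (envelope_nonneg _ _)
  rw [← ENNReal.ofReal_le_ofReal_iff (Finset.prod_nonneg fun l _ => hnonneg l), ofReal_norm,
    ENNReal.ofReal_prod_of_nonneg fun l _ => hnonneg l]
  simp only [prod_wCoeff_mul_conj_bigPsiHat]
  let a (l : Fin N) (q : ℤ × ℤ) : ℝ≥0∞ :=
    ‖wCoeff α ψ (H l) q.1 q.2 (t l) * conj (psiHat α ψ q.1 q.2 (x l))‖ₑ
  calc _ ≤ ∑ p ∈ D, ∏ l, a l (p.1 l, p.2 l) :=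
        (enorm_sum_le _ _).trans_eq (by simp only [enorm_finsetProd, a])
    _ ≤ ∑' p : (Fin N → ℤ) × (Fin N → ℤ), ∏ l, a l (p.1 l, p.2 l) := ENNReal.sum_le_tsum _
    _ = ∑' f : Fin N → ℤ × ℤ, ∏ l, a l (f l) :=
        ((Equiv.arrowProdEquivProdArrow (Fin N) (fun _ => ℤ) fun _ => ℤ).tsum_eq
          fun p => ∏ l, a l (p.1 l, p.2 l)).symm
    _ ≤ ∏ l, ∑' q, a l q := tsum_pi_prod_le_prod_tsum a
    _ ≤ _ := Finset.prod_le_prod' fun l _ => hC l (x l)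

lemma IsLemarieMeyer.ae_hasSum_kernel {ψ : 𝓢(ℝ, ℝ)} (hψ : IsLemarieMeyer ψ) {H : Fin N → ℝ}
    (hH : ∀ l, 0 ≤ H l + 1 / α) (t : Fin N → ℝ) :
    ∀ᵐ x : Fin N → ℝ, HasSum (fun p : (Fin N → ℤ) × (Fin N → ℤ) =>
      (∏ l, wCoeff α ψ (H l) (p.1 l) (p.2 l) (t l)) * conj (bigPsiHat α ψ p.1 p.2 x))
      (kernel α H t x) := by
  choose C _ hC using fun l => hψ.exists_tsum_wCoeff_mul_psiHat_le (hH l) (t l)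
  filter_upwards [ae_all_iff.2 fun l => (Measure.quasiMeasurePreserving_eval
    (fun _ : Fin N => (volume : Measure ℝ)) l).ae
      (hψ.ae_hasSum_wCoeff_mul_psiHat (hH l) (t l))] with x hx
  have hsum := hasSum_pi_prod hx fun l => ((hC l (x l)).trans_lt ENNReal.ofReal_lt_top).ne
  simp only [prod_wCoeff_mul_conj_bigPsiHat]
  exact (Equiv.arrowProdEquivProdArrow (Fin N) (fun _ => ℤ) fun _ => ℤ).hasSum_iff.1 hsum

lemma IsLemarieMeyer.tendsto_eLpNorm_sum_sub_kernel {ψ : 𝓢(ℝ, ℝ)} (hψ : IsLemarieMeyer ψ)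
    (hα : 0 < α) {H : Fin N → ℝ} (hH : ∀ l, 0 < H l ∧ H l < 1) (t : Fin N → ℝ) :
    Tendsto (fun D : Finset ((Fin N → ℤ) × (Fin N → ℤ)) => eLpNorm (fun x =>
        (∑ p ∈ D, (∏ l, wCoeff α ψ (H l) (p.1 l) (p.2 l) (t l)) *
          conj (bigPsiHat α ψ p.1 p.2 x)) - kernel α H t x)
      (ENNReal.ofReal α) volume) atTop (𝓝 0) := by
  obtain ⟨G, hG, hbound⟩ := hψ.exists_memLp_norm_sum_le hα hH t
  refine tendsto_eLpNorm_sub_of_dominated (by simpa) (by simp) (fun D => ?_)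
    (memLp_kernel hα hH t).1 hG (.of_forall hbound)
    (hψ.ae_hasSum_kernel (fun l => add_nonneg (hH l).1.le (by positivity)) t)
  exact (memLp_finsetSum _ fun p _ => (memLp_conj_bigPsiHat hα ψ p.1 p.2).const_mul _).1

lemma IsLemarieMeyer.partialSum_eq {ψ : 𝓢(ℝ, ℝ)} (hψ : IsLemarieMeyer ψ) {Ω : Type*}
    [MeasurableSpace Ω] (M : Set (Fin N → ℝ) → Ω → ℂ) (P : Measure Ω) (H : Fin N → ℝ)
    (D : Finset ((Fin N → ℤ) × (Fin N → ℤ))) (t : Fin N → ℝ) :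
    partialSum α ψ M P H D t = fun ω => (∑ p ∈ D,
      (∏ l, wCoeff α ψ (H l) (p.1 l) (p.2 l) (t l)) * epsJK α ψ M P p.1 p.2 ω).re := by
  ext ω
  rw [partialSum]
  congr 1
  refine Finset.sum_congr rfl fun p _ => ?_
  simp only [hψ.wCoeff_eq]
  rw [Finset.prod_mul_distrib, ← Complex.ofReal_prod, ← Real.rpow_sum_of_pos two_pos,
    Finset.sum_neg_distrib]
  ring

end Kernel

end

end HFSS

theorem mainTheorem3_general {N : ℕ} {Ω : Type*} [MeasurableSpace Ω] (P : Measure Ω)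
    [IsProbabilityMeasure P] (α : ℝ) (hα : 0 < α) (H : Fin N → ℝ) (hH : ∀ l, 0 < H l ∧ H l < 1)
    (ψ : 𝓢(ℝ, ℝ)) (hψ : HFSS.IsLemarieMeyer ψ) (c : ℝ) (M : Set (Fin N → ℝ) → Ω → ℂ)
    (hM : HFSS.IsStableRandomMeasure α c M P) :
    (∀ J K : Fin N → ℤ, HFSS.IsStableIntegral α M P
      (fun x => conj (HFSS.bigPsiHat α ψ J K x)) (HFSS.epsJK α ψ M P J K)) ∧
    ∀ t : Fin N → ℝ,
      HFSS.IsStableIntegral α M P (HFSS.kernel α H t)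
        (HFSS.stableIntegral α M P (HFSS.kernel α H t)) ∧
      Tendsto (fun D : Finset ((Fin N → ℤ) × (Fin N → ℤ)) => eLpNorm (fun x =>
          (∑ p ∈ D, (∏ l, HFSS.wCoeff α ψ (H l) (p.1 l) (p.2 l) (t l)) *
            conj (HFSS.bigPsiHat α ψ p.1 p.2 x)) - HFSS.kernel α H t x)
        (ENNReal.ofReal α) volume) atTop (𝓝 0) ∧
      TendstoInMeasure P (fun D => HFSS.partialSum α ψ M P H D t) atTop
        (HFSS.sheet α M P H t) := by
  have heps (J K : Fin N → ℤ) : HFSS.IsStableIntegral α M P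
      (fun x => conj (HFSS.bigPsiHat α ψ J K x)) (HFSS.epsJK α ψ M P J K) :=
    HFSS.isStableIntegral_stableIntegral hM hα (HFSS.memLp_conj_bigPsiHat hα ψ J K)
  refine ⟨heps, fun t => ?_⟩
  have hker := HFSS.isStableIntegral_stableIntegral hM hα (HFSS.memLp_kernel hα hH t)
  have hlim := hψ.tendsto_eLpNorm_sum_sub_kernel hα hH t
  refine ⟨hker, hlim, ?_⟩
  have hsum (D : Finset ((Fin N → ℤ) × (Fin N → ℤ))) :=
    HFSS.IsStableIntegral.sum_const_mul hM D (fun p => heps p.1 p.2)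
      fun p => ∏ l, HFSS.wCoeff α ψ (H l) (p.1 l) (p.2 l) (t l)
  simp only [hψ.partialSum_eq]
  exact HFSS.tendstoInMeasure_lipschitzWith_comp Complex.reCLM.lipschitz
    (HFSS.IsStableIntegral.tendstoInMeasure hM hα hsum hker hlim)

theorem mainTheorem3 {N : ℕ} {Ω : Type*} [MeasurableSpace Ω] (P : Measure Ω)
    [IsProbabilityMeasure P] (α : ℝ) (hα0 : 0 < α) (hα2 : α < 2)
    (H : Fin N → ℝ) (hH : ∀ l, 0 < H l ∧ H l < 1)
    (ψ : 𝓢(ℝ, ℝ)) (hψ : HFSS.IsLemarieMeyer ψ)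
    (c : ℝ) (hc : 0 < c) (M : Set (Fin N → ℝ) → Ω → ℂ)
    (hM : HFSS.IsStableRandomMeasure α c M P)
    (D : ℕ → Finset ((Fin N → ℤ) × (Fin N → ℤ)))
    (hDmono : ∀ n, D n ⊆ D (n + 1)) (hDunion : ∀ p, ∃ n, p ∈ D n) :
    -- the coefficients and the sheet are genuine stochastic integrals
    (∀ J K : Fin N → ℤ, HFSS.IsStableIntegral α M P
      (fun x => conj (HFSS.bigPsiHat α ψ J K x)) (HFSS.epsJK α ψ M P J K)) ∧
    ∀ t : Fin N → ℝ,
      HFSS.IsStableIntegral α M P (HFSS.kernel α H t)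
        (HFSS.stableIntegral α M P (HFSS.kernel α H t)) ∧
      -- the wavelet expansion of the kernel converges to it in `L^α`
      Tendsto (fun n => eLpNorm (fun x =>
          (∑ p ∈ D n, (∏ l, HFSS.wCoeff α ψ (H l) (p.1 l) (p.2 l) (t l)) *
            conj (HFSS.bigPsiHat α ψ p.1 p.2 x)) - HFSS.kernel α H t x)
        (ENNReal.ofReal α) volume) atTop (𝓝 0) ∧
      -- the partial sums converge in probability to the sheet
      TendstoInMeasure P (fun n => HFSS.partialSum α ψ M P H (D n) t) atTop
        (HFSS.sheet α M P H t) := by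
  obtain ⟨heps, hsheet⟩ := mainTheorem3_general P α hα0 H hH ψ hψ c M hM
  have hD : Tendsto D atTop atTop :=
    tendsto_atTop_finset_of_monotone (monotone_nat_of_le_succ hDmono) hDunion
  exact ⟨heps, fun t => ⟨(hsheet t).1, (hsheet t).2.1.comp hD, (hsheet t).2.2.comp hD⟩⟩
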